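/- Work over $\mathbb C$. Let $\Pi\subset\mathbb P^7$ be a plane, let $Q_0,Q_1,Q_2,Q_3$ be linearly independent quadratic forms in $x_0,\dots,x_7$ that vanish on $\Pi$, and let $X_{16}=Q_0\cap Q_1\cap Q_2\cap Q_3\subset\mathbb P^7$ be the scheme-theoretic intersection of the four quadrics. A point $P\in X_{16}$ is called singular if the differentials $dQ_0(P),\dots,dQ_3(P)$ are linearly dependent, i.e. if $X_{16}$ is not smooth of dimension $3$ at $P$. Assume that $X_{16}$ has exactly $10$ singular points on $\Pi$ and is smooth away from $\Pi$ (that is, all its singular points lie on $\Pi$). Then every singular point $P$ of $X_{16}$ is a node (an $A_1$ point): the completed local ring of $X_{16}$ at $P$ satisfies $$\widehat{\mathcal O}_{X_{16},P}\;\cong\;\mathbb C[[y_0,y_1,y_2,y_3]]/(y_0^2+y_1^2+y_2^2+y_3^2)$$ as a $\mathbb C$-algebra. -/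

import Mathlib

open MvPolynomial
open scoped LinearAlgebra.Projectivization

namespace QuadricWeb

/-- The complex projective space `ℙ⁷`, as the set of lines in `ℂ⁸`. -/
abbrev P7 : Type := ℙ ℂ (Fin 8 → ℂ)

/-- The plane of `ℙ⁷` (as a set of points) which is the projectivization of a linear subspace `W`
of `ℂ⁸`; it is a plane when `W` has dimension `3`. -/
def pointsOf (W : Submodule ℂ (Fin 8 → ℂ)) : Set P7 :=
  {P | P.submodule ≤ W}

/-- The set of (closed) points of the intersection of the four hypersurfaces `Q i = 0`
in `ℙ⁷` (the `Q i` are meant to be homogeneous). -/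
def baseLocus (Q : Fin 4 → MvPolynomial (Fin 8) ℂ) : Set P7 :=
  {P | ∀ i, ∀ v ∈ P.submodule, eval v (Q i) = 0}

/-- The differential of a polynomial `F` at `v`, as the row of its partial derivatives. -/
noncomputable def differential (F : MvPolynomial (Fin 8) ℂ) (v : Fin 8 → ℂ) : Fin 8 → ℂ :=
  fun k => eval v (pderiv k F)

/-- The singular points of the scheme-theoretic intersection of the four hypersurfaces `Q i = 0`:
the points of the intersection at which the Jacobian matrix has rank less than `4`, that is,
the points at which the intersection is not smooth of dimension `7 - 4 = 3`.
The condition does not depend on the representative of the point when the `Q i` are homogeneous. -/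
def singularLocus (Q : Fin 4 → MvPolynomial (Fin 8) ℂ) : Set P7 :=
  {P | P ∈ baseLocus Q ∧ ¬ LinearIndependent ℂ (fun i => differential (Q i) P.rep)}

/-- The ideal which defines, in the affine space `ℂ⁸`, the intersection of the affine hyperplane
`x_j = 1` with the hypersurfaces `Q i = 0`. -/
noncomputable def chartIdeal (Q : Fin 4 → MvPolynomial (Fin 8) ℂ) (j : Fin 8) :
    Ideal (MvPolynomial (Fin 8) ℂ) :=
  Ideal.span (Set.range Q ∪ {X j - 1})

/-- The coordinate ring `ℂ[x₀, …, x₇] / (Q₀, …, Q₃, x_j - 1)` of the affine chart `x_j ≠ 0` of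
the scheme-theoretic intersection of the hypersurfaces `Q i = 0` in `ℙ⁷`. -/
abbrev ChartRing (Q : Fin 4 → MvPolynomial (Fin 8) ℂ) (j : Fin 8) : Type :=
  MvPolynomial (Fin 8) ℂ ⧸ chartIdeal Q j

/-- The maximal ideal, in the coordinate ring of the chart `x_j ≠ 0`, of the point of the chart
with coordinates `v` (where `v j = 1`): the classes of the polynomials that vanish at `v`. -/
noncomputable def pointIdeal (Q : Fin 4 → MvPolynomial (Fin 8) ℂ) (j : Fin 8) (v : Fin 8 → ℂ) :
    Ideal (ChartRing Q j) :=
  (RingHom.ker (eval v : MvPolynomial (Fin 8) ℂ →+* ℂ)).map (Ideal.Quotient.mk (chartIdeal Q j))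

/-- The completed local ring of the scheme-theoretic intersection at the point with coordinates
`v` in the chart `x_j ≠ 0`: the inverse limit of the rings `R / 𝔪 ^ n`, where `R` is the
coordinate ring of the chart and `𝔪` the maximal ideal of the point. (As `𝔪` is maximal,
`R / 𝔪 ^ n` is also the quotient of the local ring `R_𝔪` by the `n`-th power of its maximal
ideal.) -/
abbrev CompletedLocalRing (Q : Fin 4 → MvPolynomial (Fin 8) ℂ) (j : Fin 8) (v : Fin 8 → ℂ) :
    Type :=
  AdicCompletion (pointIdeal Q j v) (ChartRing Q j)

/-- The completed local ring `ℂ⟦y₀, y₁, y₂, y₃⟧ / (y₀² + y₁² + y₂² + y₃²)` of the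
three-dimensional `A₁` singularity. -/
abbrev NodeRing : Type :=
  MvPowerSeries (Fin 4) ℂ ⧸
    Ideal.span {∑ k : Fin 4, (MvPowerSeries.X k : MvPowerSeries (Fin 4) ℂ) ^ 2}

/-- `P` is a node (an ordinary double point, or `A₁` point) of the scheme-theoretic intersection
of the hypersurfaces `Q i = 0`: it lies on the intersection and the completed local ring there is
isomorphic, as a `ℂ`-algebra, to `ℂ⟦y₀, y₁, y₂, y₃⟧ / (y₀² + y₁² + y₂² + y₃²)`. The local ring is
computed in any of the charts `x_j ≠ 0` that contain `P`; the coordinates of `P` in it are the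
vector `v` of the line `P` with `v j = 1`. -/
def IsNode (Q : Fin 4 → MvPolynomial (Fin 8) ℂ) (P : P7) : Prop :=
  P ∈ baseLocus Q ∧ ∀ (j : Fin 8) (v : Fin 8 → ℂ), v ∈ P.submodule → v j = 1 →
    Nonempty (CompletedLocalRing Q j v ≃ₐ[ℂ] NodeRing)

end QuadricWeb

/-! Write `W` for the three-dimensional space over the plane. Each quadric vanishes on `W`, so its
polar form vanishes on pairs from `W`, and the differentials at `s ∈ W` are recorded by a 4 × 5
matrix `L(s)` of linear forms on `W`. The singular points on the plane are the points where `L(s)`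
has a nonzero left kernel. Such a degeneracy locus has expected degree `C(5,2) = 10`, so ten
distinct points leave no room for multiplicity.

The global half (`mem_span_of_tangent`) makes this precise without intersection theory. Finiteness
of the locus forces the maximal minors to have no common factor, so the syzygies of `L` in degree 19
are multiples of the vector of minors by forms of degree 15. The cokernel of `L` in degree 20 then
has dimension at most `4·231 - 5·210 + 136 = 10`. Each point `p` with left kernel vector `l` gives
the functional `f ↦ l · f(p)` on this cokernel. A nontrivial first order deformation `(t, ν)` of
some pair `(p, l)` would give an eleventh, and forms of degree `20 = 2·10` separate all of them: a
contradiction.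

The local half (`nonempty_completedLocalRing_algEquiv`) takes `F = ∑ l i • Q i`, whose differential
vanishes at the point `v`. Triviality of deformations with `t = 0` makes the differentials of three
remaining quadrics `G` independent. Eliminating the three equations of `W` tangent to `G` gives `δ F
= u · G + a₀ s₀ + a₁ s₁`, where `δ(v) = 1` and `s₀, s₁` are the other two equations of `W`.
Triviality of the deformations along `W` says that `s`, `a`, `G` and `x_j - 1` are formal
coordinates at `v`, so the completed ring is that of `a₀ s₀ + a₁ s₁ = 0`, a nondegenerate quadric in
four variables. -/

namespace QuadricWeb

/-! ### Completions presented by power series modulo a homogeneous equation -/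

section Completion

variable {σ K : Type*} [Finite σ] [CommRing K]

/-- The limit of a coherent sequence of polynomials. -/
theorem exists_truncTotal_sub_mem (F : ℕ → MvPolynomial σ K)
    (hF : ∀ n, F (n + 1) - F n ∈ idealOfVars σ K ^ n) :
    ∃ f : MvPowerSeries σ K, ∀ n, f.truncTotal n - F n ∈ idealOfVars σ K ^ n := by
  have hF' : ∀ m n, m ≤ n → F n - F m ∈ idealOfVars σ K ^ m := by
    intro m n hmn
    induction n, hmn using Nat.le_induction with
    | base => simp
    | succ n hmn ih =>
      have := Ideal.add_mem _ (Ideal.pow_le_pow_right hmn (hF n)) ih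
      simpa using this
  -- A congruence modulo the `n`-th power controls the coefficients of degree less than `n`, so
  -- degree `d` is stable from index `d + 1` on.
  let f : MvPowerSeries σ K := fun x => (F (x.degree + 1)).coeff x
  refine ⟨f, fun n => (mem_pow_idealOfVars_iff' n _).2 fun x hx => ?_⟩
  have h1 := (mem_pow_idealOfVars_iff' _ _).1 (hF' (x.degree + 1) n hx) x (Nat.lt_succ_self _)
  rw [coeff_sub, MvPowerSeries.coeff_truncTotal _ hx]
  rw [coeff_sub] at h1
  have h2 : MvPowerSeries.coeff x f = (F (x.degree + 1)).coeff x := rfl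
  rw [h2, ← neg_sub, h1, neg_zero]

/-- The ideal of power series generated by a homogeneous polynomial is closed. -/
theorem mem_span_of_forall_truncTotal {q : MvPolynomial σ K} {e : ℕ} (hq : q.IsHomogeneous e)
    (f : MvPowerSeries σ K)
    (h : ∀ n, ∃ g, f.truncTotal n - q * g ∈ idealOfVars σ K ^ n) :
    f ∈ Ideal.span {(q : MvPowerSeries σ K)} := by
  classical
  choose g hg using h
  -- The `g n` need not be coherent. Since `q` is homogeneous of degree `e`, a coefficient of `q *
  -- G` in degree `d` involves `G` only in degree `d - e`, and all of these are read from the single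
  -- polynomial `g (d + 1)`.
  let G : MvPowerSeries σ K := fun x => (g (x.degree + e + 1)).coeff x
  have hG : ∀ x, MvPowerSeries.coeff x G = (g (x.degree + e + 1)).coeff x := fun _ => rfl
  refine Ideal.mem_span_singleton.2 ⟨G, ?_⟩
  ext x
  have h1 := (mem_pow_idealOfVars_iff' _ _).1 (hg (x.degree + 1)) x (Nat.lt_succ_self _)
  rw [coeff_sub, MvPowerSeries.coeff_truncTotal _ (Nat.lt_succ_self _), sub_eq_zero,
    coeff_mul] at h1
  rw [h1, MvPowerSeries.coeff_mul]
  refine Finset.sum_congr rfl fun ab hab => ?_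
  replace hab := Finset.HasAntidiagonal.mem_antidiagonal.1 hab
  rw [coeff_coe, hG]
  by_cases ha : ab.1.degree = e
  · have : ab.2.degree + e = x.degree := by rw [← hab, Finsupp.degree.map_add, ha, add_comm]
    rw [this]
  · rw [hq.coeff_eq_zero ha, zero_mul, zero_mul]

theorem sub_truncTotal_of_coe (q : MvPolynomial σ K) (G : MvPowerSeries σ K) (n : ℕ) :
    ((q : MvPowerSeries σ K) * G).truncTotal n - q * G.truncTotal n ∈ idealOfVars σ K ^ n := by
  have h1 := MvPowerSeries.truncTotal_mul_sub_mul_truncTotal_mem_pow_idealOfVars (n := n)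
    (q : MvPowerSeries σ K) G
  have h2 : (q : MvPowerSeries σ K).truncTotal n - q ∈ idealOfVars σ K ^ n :=
    (mem_pow_idealOfVars_iff' ..).2 fun x hx => by
      rw [coeff_sub, MvPowerSeries.coeff_truncTotal _ hx, coeff_coe, sub_self]
  have h3 := Ideal.add_mem _ h1 (Ideal.mul_mem_right (G.truncTotal n) _ h2)
  convert h3 using 1
  ring

/-- A criterion for the `m`-adic completion of an algebra `S` to be the quotient of a power series
ring by a homogeneous polynomial `q`: every `S / m ^ n` is presented as the polynomial ring
modulo `q` and the forms of degree at least `n`. -/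
theorem nonempty_adicCompletion_algEquiv {S : Type*} [CommRing S] [Algebra K S] (m : Ideal S)
    (u : σ → S) {q : MvPolynomial σ K} {e : ℕ} (hq : q.IsHomogeneous e)
    (hsurj : ∀ n (s : S), ∃ f : MvPolynomial σ K, s - aeval u f ∈ m ^ n)
    (hker : ∀ n (f : MvPolynomial σ K),
      aeval u f ∈ m ^ n ↔ ∃ g, f - q * g ∈ idealOfVars σ K ^ n) :
    Nonempty (AdicCompletion m S ≃ₐ[K]
      (MvPowerSeries σ K ⧸ Ideal.span {(q : MvPowerSeries σ K)})) := by
  have hvars : ∀ n, ∀ f ∈ idealOfVars σ K ^ n, aeval u f ∈ m ^ n := fun n f hf =>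
    (hker n f).2 ⟨0, by simpa using hf⟩
  let ρ : ∀ n, (MvPolynomial σ K ⧸ idealOfVars σ K ^ n) →ₐ[K] S ⧸ m ^ n := fun n =>
    Ideal.Quotient.liftₐ _ ((Ideal.Quotient.mkₐ K (m ^ n)).comp (aeval u)) fun f hf =>
      Ideal.Quotient.eq_zero_iff_mem.2 (hvars n f hf)
  let ψ : ∀ n, MvPowerSeries σ K →ₐ[K] S ⧸ m ^ n := fun n =>
    (ρ n).comp ((MvPowerSeries.truncTotalAlgHom σ K n).restrictScalars K)
  have hψ : ∀ n f, ψ n f = Ideal.Quotient.mk (m ^ n) (aeval u (f.truncTotal n)) := fun n f => rfl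
  have hcompat : ∀ {k n : ℕ} (hle : k ≤ n),
      (Ideal.Quotient.factorₐ K (Ideal.pow_le_pow_right hle)).comp (ψ n) = ψ k := by
    intro k n hle
    ext f
    rw [AlgHom.comp_apply, hψ, hψ]
    change Ideal.Quotient.mk (m ^ k) _ = _
    rw [Ideal.Quotient.eq, ← map_sub]
    exact hvars k _ (MvPowerSeries.truncTotal_sub_truncTotal_mem_pow_idealOfVars hle le_rfl f)
  let Ψ : MvPowerSeries σ K →ₐ[K] AdicCompletion m S := AdicCompletion.liftAlgHom m ψ hcompat
  have hΨ : ∀ n f, AdicCompletion.evalₐ m n (Ψ f) = ψ n f := fun n f =>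
    AdicCompletion.evalₐ_liftAlgHom _ _ _ _ _
  have hkerΨ : RingHom.ker Ψ = Ideal.span {(q : MvPowerSeries σ K)} := by
    ext f
    rw [RingHom.mem_ker]
    constructor
    · intro hf
      refine mem_span_of_forall_truncTotal hq f fun n => ?_
      rw [← hker, ← Ideal.Quotient.eq_zero_iff_mem, ← hψ, ← hΨ, hf, map_zero]
    · intro hf
      obtain ⟨G, rfl⟩ := Ideal.mem_span_singleton.1 hf
      refine AdicCompletion.ext_evalₐ fun n => ?_
      rw [hΨ, hψ, map_zero, Ideal.Quotient.eq_zero_iff_mem, hker]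
      exact ⟨_, sub_truncTotal_of_coe q G n⟩
  have hsurjΨ : Function.Surjective Ψ := by
    intro x
    have hrep : ∀ n, ∃ f : MvPolynomial σ K,
        Ideal.Quotient.mk (m ^ n) (aeval u f) = AdicCompletion.evalₐ m n x := by
      intro n
      obtain ⟨s, hs⟩ := Ideal.Quotient.mk_surjective (AdicCompletion.evalₐ m n x)
      obtain ⟨f, hf⟩ := hsurj n s
      exact ⟨f, by rw [← hs, eq_comm, Ideal.Quotient.eq]; exact hf⟩
    have hcoh : ∀ n, Ideal.Quotient.factor (Ideal.pow_le_pow_right n.le_succ)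
        (AdicCompletion.evalₐ m (n + 1) x) = AdicCompletion.evalₐ m n x := by
      obtain ⟨a, rfl⟩ := AdicCompletion.mk_surjective m S x
      intro n
      rw [AdicCompletion.evalₐ_mk, AdicCompletion.evalₐ_mk]
      exact AdicCompletion.Ideal.mk_eq_mk m n.le_succ a
    have hstep : ∀ n (f : MvPolynomial σ K),
        Ideal.Quotient.mk (m ^ n) (aeval u f) = AdicCompletion.evalₐ m n x →
        ∃ f' : MvPolynomial σ K,
          Ideal.Quotient.mk (m ^ (n + 1)) (aeval u f') = AdicCompletion.evalₐ m (n + 1) x ∧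
          f' - f ∈ idealOfVars σ K ^ n := by
      intro n f hf
      obtain ⟨F, hF⟩ := hrep (n + 1)
      have h1 : aeval u (F - f) ∈ m ^ n := by
        rw [map_sub, ← Ideal.Quotient.eq, hf, ← hcoh n, ← hF]
        rfl
      obtain ⟨g, hg⟩ := (hker n _).1 h1
      -- The lift `F` agrees with `f` only up to a multiple of `q`; subtracting that multiple leaves
      -- the image in `S / m ^ (n + 1)` unchanged, by `hker`.
      refine ⟨F - q * g, ?_, by convert hg using 1; ring⟩
      rw [← hF, Ideal.Quotient.eq, ← map_sub, hker]
      exact ⟨-g, by simp⟩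
    obtain ⟨f0, hf0⟩ := hrep 0
    let seq : ∀ n, {f : MvPolynomial σ K //
        Ideal.Quotient.mk (m ^ n) (aeval u f) = AdicCompletion.evalₐ m n x} := fun n =>
      Nat.rec ⟨f0, hf0⟩ (fun n f => ⟨(hstep n f.1 f.2).choose,
        (hstep n f.1 f.2).choose_spec.1⟩) n
    obtain ⟨f, hf⟩ := exists_truncTotal_sub_mem (fun n => (seq n).1)
      fun n => (hstep n (seq n).1 (seq n).2).choose_spec.2
    refine ⟨f, AdicCompletion.ext_evalₐ fun n => ?_⟩
    rw [hΨ, hψ, ← (seq n).2, Ideal.Quotient.eq, ← map_sub]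
    exact hvars n _ (hf n)
  exact ⟨((Ideal.quotientEquivAlgOfEq K hkerΨ.symm).trans
    (Ideal.quotientKerAlgEquivOfSurjective hsurjΨ)).symm⟩

end Completion

/-! ### Formal coordinates from independent differentials -/

section Coordinates

variable {κ τ K : Type*} [Field K]

/-- The ideal of the polynomials that vanish at `v`. -/
noncomputable abbrev vanishingAt (v : τ → K) : Ideal (MvPolynomial τ K) :=
  RingHom.ker (eval v : MvPolynomial τ K →+* K)

theorem X_sub_C_mem_vanishingAt (v : τ → K) (i : τ) : X i - C (v i) ∈ vanishingAt v := by
  simp [RingHom.mem_ker]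

theorem mem_idealOfVars_iff_constantCoeff (f : MvPolynomial κ K) :
    f ∈ idealOfVars κ K ↔ constantCoeff f = 0 := by
  have h := mem_pow_idealOfVars_iff' (σ := κ) (R := K) 1 f
  rw [pow_one] at h
  rw [h]
  constructor
  · intro h; exact h 0 (by simp)
  · intro h x hx
    have : x = 0 := by
      rw [Nat.lt_one_iff, Finsupp.degree_eq_zero_iff] at hx; exact hx
    rw [this]; exact h

variable [Fintype κ] [Fintype τ]

/-- First order Taylor expansion. -/
theorem sub_taylor_mem_sq (v : τ → K) (p : MvPolynomial τ K) :
    p - (C (eval v p) + ∑ i, C (eval v (pderiv i p)) * (X i - C (v i))) ∈ vanishingAt v ^ 2 := by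
  classical
  induction p using MvPolynomial.induction_on with
  | C a => simp
  | add p q hp hq =>
    convert Ideal.add_mem _ hp hq using 1
    simp only [map_add, add_mul, Finset.sum_add_distrib]
    ring
  | mul_X p j hp =>
    have h1 := Ideal.mul_mem_right (X j) _ hp
    have h2 : (∑ i, C (eval v (pderiv i p)) * (X i - C (v i))) * (X j - C (v j)) ∈
        vanishingAt v ^ 2 := by
      rw [pow_two]
      refine Ideal.mul_mem_mul (Ideal.sum_mem _ fun i _ => ?_) (X_sub_C_mem_vanishingAt v j)
      exact Ideal.mul_mem_left _ _ (X_sub_C_mem_vanishingAt v i)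
    convert Ideal.add_mem _ h1 h2 using 1
    have h3 : ∑ i, C (eval v (pderiv i (p * X j))) * (X i - C (v i)) =
        (∑ i, C (eval v (pderiv i p)) * (X i - C (v i))) * C (v j) +
          C (eval v p) * (X j - C (v j)) := by
      have : ∀ i, C (eval v (pderiv i (p * X j))) * (X i - C (v i)) =
          C (eval v (pderiv i p)) * (X i - C (v i)) * C (v j) +
            (if j = i then C (eval v p) * (X j - C (v j)) else 0) := by
        intro i
        rw [Derivation.leibniz, pderiv_X]
        simp only [smul_eq_mul, map_add, map_mul, eval_X]
        by_cases h : j = i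
        · subst h; simp; ring
        · simp [h]; ring
      rw [Finset.sum_congr rfl fun i _ => this i, Finset.sum_add_distrib, ← Finset.sum_mul]
      simp
    rw [h3, map_mul, eval_X, C_mul]
    ring

/-- An affine change of coordinates that sends the origin to `v` and has a prescribed
(injective) linear part. -/
theorem exists_affine_algEquiv (v : τ → K) (D : κ → τ → K)
    (hcard : Fintype.card κ = Fintype.card τ)
    (hD : ∀ u : τ → K, (∀ k, ∑ i, D k i * u i = 0) → u = 0) :
    ∃ Θ : MvPolynomial κ K ≃ₐ[K] MvPolynomial τ K,
      ∀ k, Θ (X k) = ∑ i, C (D k i) * (X i - C (v i)) := by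
  classical
  let f : (τ → K) →ₗ[K] (κ → K) := Matrix.toLin' (Matrix.of D)
  have hf : Function.Injective f := by
    rw [← LinearMap.ker_eq_bot, LinearMap.ker_eq_bot']
    intro u hu
    exact hD u fun k => congrFun hu k
  have hfs : Function.Surjective f := by
    have := LinearMap.injective_iff_surjective_of_finrank_eq_finrank (f := f)
      (by simp [hcard])
    exact this.1 hf
  let e : (τ → K) ≃ₗ[K] (κ → K) := LinearEquiv.ofBijective f ⟨hf, hfs⟩
  let E : Matrix τ κ K := LinearMap.toMatrix' e.symm.toLinearMap
  have hED : E * Matrix.of D = 1 := by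
    have : Matrix.of D = LinearMap.toMatrix' e.toLinearMap := by
      rw [show e.toLinearMap = f from rfl, LinearMap.toMatrix'_toLin']
    rw [this, ← LinearMap.toMatrix'_comp]
    simp
  have hDE : Matrix.of D * E = 1 := by
    have : Matrix.of D = LinearMap.toMatrix' e.toLinearMap := by
      rw [show e.toLinearMap = f from rfl, LinearMap.toMatrix'_toLin']
    rw [this, ← LinearMap.toMatrix'_comp]
    simp
  have hED' : ∀ i j, ∑ k, E i k * D k j = if i = j then 1 else 0 := fun i j => by
    have := congrFun (congrFun hED i) j
    rwa [Matrix.mul_apply, Matrix.one_apply] at this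
  have hDE' : ∀ i j, ∑ k, D i k * E k j = if i = j then 1 else 0 := fun i j => by
    have := congrFun (congrFun hDE i) j
    rwa [Matrix.mul_apply, Matrix.one_apply] at this
  refine ⟨AlgEquiv.ofAlgHom (aeval fun k => ∑ i, C (D k i) * (X i - C (v i)))
    (aeval fun i => C (v i) + ∑ k, C (E i k) * X k) ?_ ?_, fun k => by simp⟩
  · ext1 i
    simp only [AlgHom.comp_apply, aeval_X, map_add, map_sum, map_mul, AlgHom.id_apply,
      algHom_C, algebraMap_eq, Finset.mul_sum]
    rw [Finset.sum_comm]
    simp only [← mul_assoc, ← C_mul, ← Finset.sum_mul, ← map_sum, hED']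
    simp
  · ext1 k
    simp only [AlgHom.comp_apply, aeval_X, map_sum, map_mul, map_sub, AlgHom.id_apply,
      algHom_C, algebraMap_eq, add_sub_cancel_left, Finset.mul_sum]
    rw [Finset.sum_comm]
    simp only [← mul_assoc, ← C_mul, ← Finset.sum_mul, ← map_sum, hDE']
    simp

/-- If the polynomials `w k` vanish at `v` and have independent differentials there, then they
are formal coordinates at `v`. -/
theorem coordinates_at (v : τ → K) (w : κ → MvPolynomial τ K)
    (hcard : Fintype.card κ = Fintype.card τ) (hw : ∀ k, eval v (w k) = 0)
    (hD : ∀ u : τ → K, (∀ k, ∑ i, eval v (pderiv i (w k)) * u i = 0) → u = 0) (n : ℕ) :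
    (∀ p, ∃ f : MvPolynomial κ K, p - aeval w f ∈ vanishingAt v ^ n) ∧
      ∀ f : MvPolynomial κ K, aeval w f ∈ vanishingAt v ^ n ↔ f ∈ idealOfVars κ K ^ n := by
  -- `Θ` is the linearization of `w` at `v`. Both claims are clear for this affine isomorphism, and
  -- they transfer because `w` and `Θ` induce the same map on the graded pieces (`hdiff`).
  obtain ⟨Θ, hΘ⟩ := exists_affine_algEquiv v (fun k i => eval v (pderiv i (w k))) hcard hD
  set M := vanishingAt v with hM
  have hevΘ : ∀ f, eval v (Θ f) = constantCoeff f := by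
    intro f
    have : ((aeval v : MvPolynomial τ K →ₐ[K] K).comp Θ.toAlgHom) =
        (aeval (0 : κ → K) : MvPolynomial κ K →ₐ[K] K) := by
      ext k
      simp [hΘ]
    have h := congrArg (fun g => g f) this
    simpa [aeval_eq_eval, constantCoeff_eq, eval_zero] using h
  have hevw : ∀ f, eval v (aeval w f) = constantCoeff f := by
    intro f
    have : ((aeval v : MvPolynomial τ K →ₐ[K] K).comp (aeval w)) =
        (aeval (0 : κ → K) : MvPolynomial κ K →ₐ[K] K) := by
      ext k
      simp [hw, aeval_eq_eval]
    have h := congrArg (fun g => g f) this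
    simpa [aeval_eq_eval, constantCoeff_eq, eval_zero] using h
  have hmap : (idealOfVars κ K).map Θ = M := by
    ext p
    obtain ⟨f, rfl⟩ := Θ.surjective p
    rw [Ideal.mem_map_iff_of_surjective _ Θ.surjective]
    simp only [hM, RingHom.mem_ker, hevΘ]
    constructor
    · rintro ⟨g, hg, hgf⟩
      obtain rfl := Θ.injective hgf
      exact (mem_idealOfVars_iff_constantCoeff _).1 hg
    · intro h
      exact ⟨f, (mem_idealOfVars_iff_constantCoeff _).2 h, rfl⟩
  have hΘpow : ∀ d f, Θ f ∈ M ^ d ↔ f ∈ idealOfVars κ K ^ d := by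
    intro d f
    rw [← hmap, ← Ideal.map_pow, Ideal.mem_map_iff_of_surjective _ Θ.surjective]
    constructor
    · rintro ⟨g, hg, hgf⟩
      obtain rfl := Θ.injective hgf
      exact hg
    · intro h
      exact ⟨f, h, rfl⟩
  have hdiff0 : ∀ f, aeval w f - Θ f ∈ M := by
    intro f
    rw [hM, RingHom.mem_ker, map_sub, hevΘ, hevw, sub_self]
  have hdiffX : ∀ k, w k - Θ (X k) ∈ M ^ 2 := by
    intro k
    have := sub_taylor_mem_sq v (w k)
    rwa [hw, map_zero, zero_add, ← hΘ] at this
  have hdiff1 : ∀ f ∈ idealOfVars κ K, aeval w f - Θ f ∈ M ^ 2 := by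
    intro f hf
    refine Submodule.span_induction (p := fun f _ => aeval w f - Θ f ∈ M ^ 2) ?_ ?_ ?_ ?_ hf
    · rintro _ ⟨k, rfl⟩
      rw [aeval_X]; exact hdiffX k
    · simp
    · intro x y _ _ hx hy
      convert Ideal.add_mem _ hx hy using 1
      simp only [map_add]; ring
    · intro a x hx' hx
      have h1 : Θ x ∈ M := by
        have := (hΘpow 1 x).2 (by rwa [pow_one]); rwa [pow_one] at this
      have h2 : (aeval w a - Θ a) * Θ x ∈ M ^ 2 := by
        rw [pow_two]; exact Ideal.mul_mem_mul (hdiff0 a) h1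
      convert Ideal.add_mem _ (Ideal.mul_mem_left _ (aeval w a) hx) h2 using 1
      simp only [smul_eq_mul, map_mul]; ring
  have hdiff : ∀ d, ∀ f ∈ idealOfVars κ K ^ d, aeval w f - Θ f ∈ M ^ (d + 1) := by
    intro d
    induction d with
    | zero => intro f _; rw [zero_add, pow_one]; exact hdiff0 f
    | succ d ih =>
      intro f hf
      rw [pow_succ] at hf
      refine Submodule.mul_induction_on hf ?_ ?_
      · intro g hg x hx
        have h1 : Θ x ∈ M := by
          have := (hΘpow 1 x).2 (by rwa [pow_one]); rwa [pow_one] at this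
        have h2 : aeval w g ∈ M ^ d := by
          have := Ideal.add_mem _ (Ideal.pow_le_pow_right d.le_succ (ih g hg)) ((hΘpow d g).2 hg)
          rwa [sub_add_cancel] at this
        have h3 : aeval w g * (aeval w x - Θ x) ∈ M ^ (d + 1 + 1) := by
          rw [show d + 1 + 1 = d + 2 from rfl, pow_add]
          exact Ideal.mul_mem_mul h2 (hdiff1 x hx)
        have h4 : (aeval w g - Θ g) * Θ x ∈ M ^ (d + 1 + 1) := by
          rw [pow_succ _ (d + 1)]
          exact Ideal.mul_mem_mul (ih g hg) h1
        convert Ideal.add_mem _ h3 h4 using 1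
        simp only [map_mul]; ring
      · intro x y hx hy
        convert Ideal.add_mem _ hx hy using 1
        simp only [map_add]; ring
  have hmem : ∀ d, ∀ f ∈ idealOfVars κ K ^ d, aeval w f ∈ M ^ d := by
    intro d f hf
    have := Ideal.add_mem _ (Ideal.pow_le_pow_right d.le_succ (hdiff d f hf)) ((hΘpow d f).2 hf)
    rwa [sub_add_cancel] at this
  constructor
  · intro p
    suffices h : ∀ d, ∃ f : MvPolynomial κ K, p - aeval w f ∈ M ^ d from h n
    intro d
    induction d with
    | zero => exact ⟨0, by simp⟩
    | succ d ih =>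
      obtain ⟨f, hf⟩ := ih
      obtain ⟨g, hg⟩ := Θ.surjective (p - aeval w f)
      rw [← hg] at hf
      refine ⟨f + g, ?_⟩
      have := hdiff d g ((hΘpow d g).1 hf)
      rw [hg] at this
      rw [← neg_mem_iff]
      convert this using 1
      simp only [map_add]; ring
  · intro f
    refine ⟨fun hf => ?_, hmem n f⟩
    suffices h : ∀ d, d ≤ n → f ∈ idealOfVars κ K ^ d from h n le_rfl
    intro d
    induction d with
    | zero => intro _; simp
    | succ d ih =>
      intro hd
      rw [← hΘpow]
      -- With `f` in the `d`-th power already, `aeval w f` and `Θ f` agree modulo `M ^ (d + 1)`, so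
      -- the order of `f` rises by one as long as `d < n`.
      have := Ideal.sub_mem _ (Ideal.pow_le_pow_right hd hf) (hdiff d f (ih (by lia)))
      rwa [sub_sub_cancel] at this

end Coordinates

/-! ### Local presentation by a partial system of coordinates -/

section Presentation

variable {σ ρ τ K : Type*} [Fintype σ] [Fintype ρ] [Fintype τ] [Field K]

/-- The completed local ring at `v` of the scheme defined by an ideal `I` which is generated,
modulo every power of the ideal of `v`, by a part of a system of formal coordinates and by a
homogeneous polynomial in the other coordinates. -/
theorem nonempty_adicCompletion_algEquiv_of_coordinates (v : τ → K)
    (I : Ideal (MvPolynomial τ K)) (w : σ → MvPolynomial τ K) (z : ρ → MvPolynomial τ K)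
    (hcard : Fintype.card σ + Fintype.card ρ = Fintype.card τ)
    (hw : ∀ k, eval v (w k) = 0) (hz : ∀ k, eval v (z k) = 0)
    (hD : ∀ u : τ → K, (∀ k, ∑ i, eval v (pderiv i (w k)) * u i = 0) →
      (∀ k, ∑ i, eval v (pderiv i (z k)) * u i = 0) → u = 0)
    {q : MvPolynomial σ K} {e : ℕ} (hq : q.IsHomogeneous e)
    (hI : ∀ n, I ⊔ vanishingAt v ^ n =
      Ideal.span (Set.range z ∪ {aeval w q}) ⊔ vanishingAt v ^ n) :
    Nonempty (AdicCompletion ((vanishingAt v).map (Ideal.Quotient.mk I)) (MvPolynomial τ K ⧸ I)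
      ≃ₐ[K] (MvPowerSeries σ K ⧸ Ideal.span {(q : MvPowerSeries σ K)})) := by
  set M := vanishingAt v with hM
  let W : σ ⊕ ρ → MvPolynomial τ K := Sum.elim w z
  have hW := coordinates_at v W (by simpa using hcard)
    (by rintro (k | k); exacts [hw k, hz k])
    (fun u hu => hD u (fun k => hu (Sum.inl k)) fun k => hu (Sum.inr k))
  have hmk : ∀ n p, Ideal.Quotient.mk I p ∈ (M.map (Ideal.Quotient.mk I)) ^ n ↔
      p ∈ I ⊔ M ^ n := by
    intro n p
    rw [← Ideal.map_pow, Ideal.mem_quotient_iff_mem_sup, sup_comm]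
  have haev : ∀ f : MvPolynomial σ K,
      aeval (fun k => Ideal.Quotient.mk I (w k)) f = Ideal.Quotient.mk I (aeval w f) := by
    intro f
    exact (comp_aeval_apply w (Ideal.Quotient.mkₐ K I) f).symm
  let i₁ : MvPolynomial σ K →ₐ[K] MvPolynomial (σ ⊕ ρ) K := rename Sum.inl
  -- Setting the coordinates `z` to zero is the quotient by these equations.
  let π₁ : MvPolynomial (σ ⊕ ρ) K →ₐ[K] MvPolynomial σ K := aeval (Sum.elim X fun _ => 0)
  have hπi : ∀ f, π₁ (i₁ f) = f := by
    intro f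
    simp only [π₁, i₁, aeval_rename, Sum.elim_comp_inl]
    exact aeval_X_left_apply f
  have hWi : ∀ f, aeval W (i₁ f) = aeval w f := by
    intro f
    simp only [i₁, aeval_rename, W, Sum.elim_comp_inl]
  have hker : RingHom.ker π₁ = Ideal.span (Set.range fun k => (X (Sum.inr k) : MvPolynomial (σ ⊕ ρ) K)) := by
    refine le_antisymm (fun f hf => ?_) ?_
    · have h1 : ∀ f : MvPolynomial (σ ⊕ ρ) K, f - i₁ (π₁ f) ∈
          Ideal.span (Set.range fun k => (X (Sum.inr k) : MvPolynomial (σ ⊕ ρ) K)) := by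
        intro f
        rw [← Ideal.Quotient.eq]
        have : (Ideal.Quotient.mkₐ K (Ideal.span (Set.range fun k =>
            (X (Sum.inr k) : MvPolynomial (σ ⊕ ρ) K)))) =
            (Ideal.Quotient.mkₐ K _).comp (i₁.comp π₁) := by
          ext k
          rcases k with k | k
          · simp [i₁, π₁]
          · simp only [Ideal.Quotient.mkₐ_eq_mk, AlgHom.coe_comp, Function.comp_apply, π₁, aeval_X,
              Sum.elim_inr, map_zero]
            exact Ideal.Quotient.eq_zero_iff_mem.2 (Ideal.subset_span ⟨k, rfl⟩)
        exact congrArg (fun g => g f) this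
      have := h1 f
      rwa [RingHom.mem_ker.1 hf, map_zero, sub_zero] at this
    · rw [Ideal.span_le]
      rintro _ ⟨k, rfl⟩
      simp [RingHom.mem_ker, π₁]
  -- Modulo `M ^ n`, members of the ideal are polynomials in the coordinates that become multiples
  -- of `q` once `z = 0`; arbitrary coefficients `a` are first approximated by polynomials in the
  -- coordinates.
  have hzmem : ∀ n, ∀ p ∈ Ideal.span (Set.range z ∪ {aeval w q}), ∃ f g : MvPolynomial (σ ⊕ ρ) K,
      π₁ f = q * π₁ g ∧ p - aeval W f ∈ M ^ n := by
    intro n p hp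
    refine Submodule.span_induction (p := fun p _ => ∃ f g : MvPolynomial (σ ⊕ ρ) K,
      π₁ f = q * π₁ g ∧ p - aeval W f ∈ M ^ n) ?_ ?_ ?_ ?_ hp
    · rintro x (⟨k, rfl⟩ | hx)
      · exact ⟨X (Sum.inr k), 0, by simp [π₁], by simp [W]⟩
      · refine ⟨i₁ q, 1, by simp [hπi], ?_⟩
        rw [Set.mem_singleton_iff.1 hx, hWi, sub_self]; exact zero_mem _
    · exact ⟨0, 0, by simp, by simp⟩
    · rintro x y _ _ ⟨f, g, h1, h2⟩ ⟨f', g', h1', h2'⟩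
      refine ⟨f + f', g + g', by rw [map_add, map_add, h1, h1', mul_add], ?_⟩
      convert Ideal.add_mem _ h2 h2' using 1
      simp only [map_add]; ring
    · rintro a x _ ⟨f, g, h1, h2⟩
      obtain ⟨b, hb⟩ := (hW n).1 a
      refine ⟨b * f, b * g, by rw [map_mul, map_mul, h1]; ring, ?_⟩
      convert Ideal.add_mem _ (Ideal.mul_mem_left _ a h2)
        (Ideal.mul_mem_right (aeval W f) _ hb) using 1
      simp only [map_mul, smul_eq_mul]; ring
  have hπmem : ∀ n, ∀ f ∈ idealOfVars (σ ⊕ ρ) K ^ n, π₁ f ∈ idealOfVars σ K ^ n := by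
    intro n f hf
    have h1 : (idealOfVars (σ ⊕ ρ) K).map (π₁ : MvPolynomial (σ ⊕ ρ) K →+* MvPolynomial σ K) ≤
        idealOfVars σ K := by
      rw [Ideal.map_span, Ideal.span_le]
      rintro _ ⟨_, ⟨k | k, rfl⟩, rfl⟩
      · simpa [π₁] using Ideal.subset_span (Set.mem_range_self k)
      · simp [π₁]
    refine Ideal.pow_right_mono h1 n ?_
    rw [← Ideal.map_pow]
    exact Ideal.mem_map_of_mem _ hf
  refine nonempty_adicCompletion_algEquiv (M.map (Ideal.Quotient.mk I))
    (fun k => Ideal.Quotient.mk I (w k)) hq ?_ ?_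
  · intro n s
    obtain ⟨p, rfl⟩ := Ideal.Quotient.mk_surjective s
    obtain ⟨f, hf⟩ := (hW n).1 p
    refine ⟨π₁ f, ?_⟩
    rw [haev, ← map_sub, hmk, hI]
    have h1 : aeval W f - aeval w (π₁ f) ∈ Ideal.span (Set.range z ∪ {aeval w q}) := by
      have h2 : f - i₁ (π₁ f) ∈ RingHom.ker π₁ := by
        rw [RingHom.mem_ker, map_sub, hπi, sub_self]
      rw [hker] at h2
      have h3 := Ideal.mem_map_of_mem (aeval W : MvPolynomial (σ ⊕ ρ) K →ₐ[K] _) h2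
      rw [map_sub, hWi, Ideal.map_span] at h3
      refine Ideal.span_mono ?_ h3
      rintro _ ⟨_, ⟨k, rfl⟩, rfl⟩
      exact Or.inl ⟨k, by simp [W]⟩
    have := Ideal.add_mem _ (Ideal.mem_sup_left h1) (Ideal.mem_sup_right hf)
    convert this using 1
    ring
  · intro n f
    rw [haev, hmk, hI]
    constructor
    · intro hf
      obtain ⟨a, ha, b, hb, hab⟩ := Submodule.mem_sup.1 hf
      obtain ⟨F, G, h1, h2⟩ := hzmem n a ha
      refine ⟨π₁ G, ?_⟩
      rw [← h1, ← hπi f, ← map_sub]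
      apply hπmem
      rw [← (hW n).2, map_sub, hWi, ← hab]
      convert Ideal.add_mem _ h2 hb using 1
      ring
    · rintro ⟨g, hg⟩
      have h1 : i₁ (f - q * g) ∈ idealOfVars (σ ⊕ ρ) K ^ n := by
        have h1 : (idealOfVars σ K).map (i₁ : MvPolynomial σ K →+* MvPolynomial (σ ⊕ ρ) K) ≤
            idealOfVars (σ ⊕ ρ) K := by
          rw [Ideal.map_span, Ideal.span_le]
          rintro _ ⟨_, ⟨k, rfl⟩, rfl⟩
          simpa [i₁] using Ideal.subset_span (Set.mem_range_self (Sum.inl k))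
        refine Ideal.pow_right_mono h1 n ?_
        rw [← Ideal.map_pow]
        exact Ideal.mem_map_of_mem _ hg
      rw [← (hW n).2, hWi, map_sub, map_mul] at h1
      have h2 : aeval w q * aeval w g ∈ Ideal.span (Set.range z ∪ {aeval w q}) :=
        Ideal.mul_mem_right _ _ (Ideal.subset_span (Or.inr rfl))
      have := Ideal.add_mem _ (Ideal.mem_sup_right h1) (Ideal.mem_sup_left h2)
      convert this using 1
      ring

end Presentation

/-! ### Maximal minors of an `n × (n + 1)` matrix -/

section Minors

variable {R : Type*} {n : ℕ}

/-- The square matrix obtained by adding a row on top of an `n × (n + 1)` matrix. -/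
def bordered (r : Fin (n + 1) → R) (A : Matrix (Fin n) (Fin (n + 1)) R) :
    Matrix (Fin (n + 1)) (Fin (n + 1)) R :=
  Matrix.of (Fin.cons r A)

@[simp]
theorem bordered_zero (r : Fin (n + 1) → R) (A : Matrix (Fin n) (Fin (n + 1)) R) :
    bordered r A 0 = r := rfl

@[simp]
theorem bordered_succ (r : Fin (n + 1) → R) (A : Matrix (Fin n) (Fin (n + 1)) R) (a : Fin n) :
    bordered r A a.succ = A a := rfl

variable [CommRing R]

/-- The signed maximal minors of an `n × (n + 1)` matrix. -/
def maxMinor (A : Matrix (Fin n) (Fin (n + 1)) R) (i : Fin (n + 1)) : R :=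
  (bordered (Pi.single i 1) A).det

/-- The cofactors along the top row do not involve that row. -/
theorem adjugate_bordered_apply_zero (r : Fin (n + 1) → R) (A : Matrix (Fin n) (Fin (n + 1)) R)
    (i : Fin (n + 1)) : (bordered r A).adjugate i 0 = maxMinor A i := by
  rw [Matrix.adjugate_apply, maxMinor]
  congr 1
  ext a b
  refine Fin.cases ?_ (fun a => ?_) a
  · simp
  · simp [Matrix.updateRow_apply]

theorem det_bordered (r : Fin (n + 1) → R) (A : Matrix (Fin n) (Fin (n + 1)) R) :
    (bordered r A).det = ∑ i, r i * maxMinor A i := by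
  have h := congrFun (congrFun (Matrix.mul_adjugate (bordered r A)) 0) 0
  rw [Matrix.mul_apply] at h
  simp only [adjugate_bordered_apply_zero] at h
  simpa using h.symm

/-- A vector in the kernel of an `n × (n + 1)` matrix is proportional to the vector of the
maximal minors. -/
theorem maxMinor_mul_eq_of_mulVec_eq_zero {A : Matrix (Fin n) (Fin (n + 1)) R}
    {g : Fin (n + 1) → R} (hg : A.mulVec g = 0) (i j : Fin (n + 1)) :
    maxMinor A j * g i = g j * maxMinor A i := by
  -- Multiplying this identity by the adjugate, whose first column consists of the minors, gives the
  -- proportionality.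
  have h1 : (bordered (Pi.single j 1) A).mulVec g = Pi.single 0 (g j) := by
    ext a
    refine Fin.cases ?_ (fun a => ?_) a
    · simp [Matrix.mulVec]
    · simpa [Matrix.mulVec] using congrFun hg a
  have h2 := congrArg (fun x => (bordered (Pi.single j 1) A).adjugate.mulVec x i) h1
  simp only [Matrix.mulVec_mulVec, Matrix.adjugate_mul, Matrix.smul_mulVec,
    Matrix.one_mulVec, Matrix.mulVec_single, Pi.smul_apply, smul_eq_mul] at h2
  simpa [adjugate_bordered_apply_zero, maxMinor, mul_comm] using h2

/-- Independent rows could be completed by a row `r` to an invertible matrix, whose determinant is a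
combination of the minors. -/
theorem exists_vecMul_eq_zero_of_maxMinor_eq_zero {K : Type*} [Field K]
    {A : Matrix (Fin n) (Fin (n + 1)) K} (hA : ∀ i, maxMinor A i = 0) :
    ∃ l : Fin n → K, l ≠ 0 ∧ Matrix.vecMul l A = 0 := by
  by_contra! hcon
  have hli : LinearIndependent K A.row := by
    rw [Fintype.linearIndependent_iff]
    intro l hl
    by_contra! hne
    obtain ⟨i, hi⟩ := hne
    refine hcon l (fun h => hi (congrFun h i)) ?_
    ext j
    simpa [Matrix.vecMul, dotProduct, Matrix.row] using congrFun hl j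
  obtain ⟨r, hr⟩ := exists_linearIndependent_cons_of_lt_finrank hli (by simp)
  have h1 : IsUnit (bordered r A) := by
    rw [← Matrix.linearIndependent_rows_iff_isUnit]
    exact hr
  rw [Matrix.isUnit_iff_isUnit_det, det_bordered] at h1
  simp [hA] at h1

end Minors

/-! ### Zeros of a polynomial along lines -/

section Roots

variable {σ K : Type*} [Field K]

theorem coeff_prod_line (a b : σ → K) (d : σ → ℕ) (s : Finset σ) :
    (∏ i ∈ s, (Polynomial.C (a i) + Polynomial.X * Polynomial.C (b i)) ^ d i).natDegree ≤
        ∑ i ∈ s, d i ∧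
      (∏ i ∈ s, (Polynomial.C (a i) + Polynomial.X * Polynomial.C (b i)) ^ d i).coeff
        (∑ i ∈ s, d i) = ∏ i ∈ s, b i ^ d i := by
  classical
  induction s using Finset.induction_on with
  | empty => simp
  | insert i s hi ih =>
    have h1 : (Polynomial.C (a i) + Polynomial.X * Polynomial.C (b i)).natDegree ≤ 1 := by
      compute_degree
    have h2 : ((Polynomial.C (a i) + Polynomial.X * Polynomial.C (b i)) ^ d i).natDegree ≤
        d i := by
      simpa using Polynomial.natDegree_pow_le_of_le (d i) h1
    rw [Finset.prod_insert hi, Finset.sum_insert hi, Finset.prod_insert hi]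
    refine ⟨Polynomial.natDegree_mul_le_of_le h2 ih.1, ?_⟩
    rw [Polynomial.coeff_mul_add_eq_of_natDegree_le h2 ih.1, ih.2]
    have h3 := Polynomial.coeff_pow_of_natDegree_le (m := d i) h1
    rw [mul_one] at h3
    rw [h3]
    simp [Polynomial.coeff_C]

/-- A polynomial which is not a unit has a zero on every line of a suitable direction. -/
theorem exists_direction_of_not_isUnit [Fintype σ] [IsAlgClosed K] {c : MvPolynomial σ K}
    (hc : ¬ IsUnit c) :
    ∃ b : σ → K, ∀ a : σ → K, ∃ t : K, eval (a + t • b) c = 0 := by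
  classical
  by_cases h0 : c.totalDegree = 0
  · rw [totalDegree_eq_zero_iff_eq_C] at h0
    have h1 : coeff 0 c = 0 := by
      by_contra h
      exact hc (h0 ▸ (isUnit_iff_ne_zero.2 h).map C)
    rw [h0, h1]
    exact ⟨0, fun a => ⟨0, by simp⟩⟩
  have hc0 : c ≠ 0 := fun h => h0 (by rw [h, totalDegree_zero])
  set N := c.totalDegree with hN
  have htop : homogeneousComponent N c ≠ 0 := by
    intro h
    obtain ⟨m, hm, hmN⟩ := Finset.exists_mem_eq_sup c.support (support_nonempty.2 hc0)
      (fun s => s.degree)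
    have h1 : m.degree = N := by
      rw [← hmN, hN]; rfl
    have h2 := congrArg (coeff m) h
    rw [coeff_homogeneousComponent, if_pos h1, coeff_zero] at h2
    exact (mem_support_iff.1 hm) h2
  -- Where the top component does not vanish at `b`, the restriction of `c` to every line of
  -- direction `b` has the same nonzero coefficient in degree `N > 0`, whatever the base point.
  obtain ⟨b, hb⟩ : ∃ b, eval b (homogeneousComponent N c) ≠ 0 := by
    by_contra! h
    exact htop (MvPolynomial.funext fun x => by rw [h x, map_zero])
  refine ⟨b, fun a => ?_⟩
  let g : Polynomial K := aeval (fun i => Polynomial.C (a i) + Polynomial.X * Polynomial.C (b i)) c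
  have hg : g.coeff N = eval b (homogeneousComponent N c) := by
    have hdeg : ∀ m : σ →₀ ℕ, ∑ i, m i = m.degree := fun m =>
      (Finsupp.degree_eq_sum m).symm
    simp only [g, aeval_def, eval₂_eq', Polynomial.finsetSum_coeff, Polynomial.algebraMap_eq,
      Polynomial.coeff_C_mul]
    rw [homogeneousComponent_apply, map_sum, Finset.sum_filter]
    refine Finset.sum_congr rfl fun m hm => ?_
    obtain ⟨h1, h2⟩ := coeff_prod_line a b m Finset.univ
    rw [hdeg] at h1 h2
    split_ifs with hmN
    · rw [← hmN, h2, eval_monomial, Finsupp.prod_fintype _ _ (by simp)]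
    · have h3 : m.degree < N := lt_of_le_of_ne (le_totalDegree hm) hmN
      rw [Polynomial.coeff_eq_zero_of_natDegree_lt (h1.trans_lt h3), mul_zero]
  have hdeg : g.degree ≠ 0 := by
    intro h
    have h1 := Polynomial.natDegree_eq_of_degree_eq_some h
    exact hb (hg ▸ Polynomial.coeff_eq_zero_of_natDegree_lt (by
      rw [h1]; exact Nat.pos_of_ne_zero h0))
  obtain ⟨t, ht⟩ := IsAlgClosed.exists_root g hdeg
  refine ⟨t, ?_⟩
  rw [Polynomial.IsRoot, ← Polynomial.coe_aeval_eq_eval] at ht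
  have h1 : ((Polynomial.aeval t).restrictScalars K).comp (aeval (fun i => Polynomial.C (a i) +
      Polynomial.X * Polynomial.C (b i))) = (aeval (a + t • b) : MvPolynomial σ K →ₐ[K] K) := by
    ext i
    simp
    ring
  have h2 := congrArg (fun φ => φ c) h1
  rw [← coe_aeval_eq_eval]
  exact h2.symm.trans ht

end Roots

/-! ### Dimensions of spaces of forms; proportional vectors over a factorial ring -/

/-- The dimension of the space of forms of degree `d`. -/
theorem finrank_homogeneousSubmodule (σ K : Type*) [Fintype σ] [Field K] (d : ℕ) :
    Module.finrank K (homogeneousSubmodule σ K d) = (Fintype.card σ + d - 1).choose d := by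
  classical
  rw [homogeneousSubmodule_eq_finsupp_supported]
  have h := Module.finrank_eq_nat_card_basis (basisRestrictSupport K {m : σ →₀ ℕ | m.degree = d})
  refine h.trans ?_
  have h2 : {m : σ →₀ ℕ | m.degree = d} = (Finset.univ.finsuppAntidiag d : Finset (σ →₀ ℕ)) := by
    ext m
    simp [Finset.mem_finsuppAntidiag, Finsupp.degree_eq_sum]
  rw [h2, Nat.card_coe_set_eq, Set.ncard_coe_finset, Finset.card_finsuppAntidiag_nat_eq_choose,
    Finset.card_univ]

/-- For one `j` with `Δ j ≠ 0`, proportionality makes `Δ j` divide `g j` times the gcd of the `Δ i`,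
which is a unit. The quotient `g j / Δ j` then serves for every index. -/
theorem exists_eq_mul_of_proportional {R ι : Type*} [CommRing R] [IsDomain R]
    [UniqueFactorizationMonoid R] [Fintype ι] (Δ g : ι → R)
    (h : ∀ i j, Δ j * g i = g j * Δ i) (hΔ : ∀ c, (∀ i, c ∣ Δ i) → IsUnit c) :
    ∃ a, ∀ i, g i = a * Δ i := by
  classical
  let _ : NormalizedGCDMonoid R := Classical.arbitrary _
  obtain ⟨j, hj⟩ : ∃ j, Δ j ≠ 0 := by
    by_contra! hcon
    exact not_isUnit_zero (hΔ 0 fun i => by rw [hcon i])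
  have h1 : IsUnit (Finset.univ.gcd Δ) := hΔ _ fun i => Finset.gcd_dvd (Finset.mem_univ i)
  have h2 : Δ j ∣ g j := by
    have h3 : Δ j ∣ Finset.univ.gcd fun i => g j * Δ i :=
      Finset.dvd_gcd fun i _ => ⟨g i, (h i j).symm⟩
    have h4 := h3.trans (Finset.gcd_mul_left' Finset.univ Δ (g j)).dvd
    exact h1.dvd_mul_right.1 h4
  obtain ⟨a, ha⟩ := h2
  refine ⟨a, fun i => mul_left_cancel₀ hj ?_⟩
  rw [h i j, ha]
  ring

/-! ### Linear forms and directional derivatives -/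

section LinearForms

variable {σ K : Type*} [Fintype σ] [Field K]

/-- The linear form with given coefficients. -/
noncomputable def linForm (m : σ → K) : MvPolynomial σ K := ∑ k, C (m k) * X k

theorem isHomogeneous_linForm (m : σ → K) : (linForm m).IsHomogeneous 1 :=
  IsHomogeneous.sum _ _ _ fun _ _ => isHomogeneous_C_mul_X _ _

@[simp]
theorem eval_linForm (m s : σ → K) : eval s (linForm m) = ∑ k, m k * s k := by
  simp [linForm]

theorem pderiv_linForm (m : σ → K) (k : σ) : pderiv k (linForm m) = C (m k) := by
  classical
  simp only [linForm, map_sum, pderiv_C_mul, pderiv_X, Pi.single_apply]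
  simp

/-- The derivative of a polynomial at `p` in the direction `t`. -/
noncomputable def dirDeriv (p t : σ → K) : MvPolynomial σ K →ₗ[K] K where
  toFun f := ∑ k, t k * eval p (pderiv k f)
  map_add' f g := by simp only [map_add, mul_add, Finset.sum_add_distrib]
  map_smul' c f := by
    simp only [Derivation.map_smul, smul_eval, RingHom.id_apply, smul_eq_mul, Finset.mul_sum]
    exact Finset.sum_congr rfl fun k _ => by ring

theorem dirDeriv_apply (p t : σ → K) (f : MvPolynomial σ K) :
    dirDeriv p t f = ∑ k, t k * eval p (pderiv k f) := rfl

theorem dirDeriv_mul (p t : σ → K) (f g : MvPolynomial σ K) :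
    dirDeriv p t (f * g) = dirDeriv p t f * eval p g + eval p f * dirDeriv p t g := by
  simp only [dirDeriv_apply, Derivation.leibniz, smul_eq_mul, map_add, map_mul, mul_add,
    Finset.sum_add_distrib, Finset.sum_mul, Finset.mul_sum]
  rw [add_comm]
  congr 1 <;> exact Finset.sum_congr rfl fun k _ => by ring

@[simp]
theorem dirDeriv_linForm (p t m : σ → K) : dirDeriv p t (linForm m) = ∑ k, m k * t k := by
  simp only [dirDeriv_apply, pderiv_linForm, eval_C]
  exact Finset.sum_congr rfl fun k _ => mul_comm _ _

theorem dirDeriv_sq_mul_eq_zero (p t : σ → K) {f : MvPolynomial σ K} (hf : eval p f = 0)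
    (g : MvPolynomial σ K) : dirDeriv p t (f ^ 2 * g) = 0 := by
  rw [dirDeriv_mul, pow_two, dirDeriv_mul, map_mul, hf]
  ring

theorem exists_linForm_of_notMem_span {x y : σ → K} (h : x ∉ Submodule.span K {y}) :
    ∃ m : σ → K, eval y (linForm m) = 0 ∧ eval x (linForm m) = 1 := by
  classical
  obtain ⟨f, hf, hfy⟩ := Submodule.exists_dual_map_eq_bot_of_notMem h inferInstance
  have h1 : ∀ z, ∑ k, f (Pi.single k 1) * z k = f z := by
    intro z
    conv_rhs => rw [← Finset.univ_sum_single z, map_sum]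
    refine Finset.sum_congr rfl fun k _ => ?_
    rw [mul_comm, ← smul_eq_mul, ← map_smul, ← Pi.single_smul, smul_eq_mul, mul_one]
  have h2 : f y = 0 := by
    have : f y ∈ (Submodule.span K {y}).map f :=
      Submodule.mem_map_of_mem (Submodule.mem_span_singleton_self y)
    rwa [hfy, Submodule.mem_bot] at this
  refine ⟨fun k => (f x)⁻¹ * f (Pi.single k 1), ?_, ?_⟩
  · simp only [eval_linForm, mul_assoc, ← Finset.mul_sum, h1, h2, mul_zero]
  · simp only [eval_linForm, mul_assoc, ← Finset.mul_sum, h1]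
    exact inv_mul_cancel₀ hf

end LinearForms

/-! ### Matrices of linear forms and their degeneracy -/

section Pencil

variable {K : Type*} [Field K] {a b : ℕ} {σ : Type*} [Fintype σ]

/-- The value at `s` of the linear matrix with coefficients `L`. -/
def linMatrix (L : σ → Matrix (Fin a) (Fin b) K) (s : σ → K) : Matrix (Fin a) (Fin b) K :=
  Matrix.of fun i j => ∑ k, L k i j * s k

/-- The linear matrix with coefficients `L`, as a matrix of linear forms. -/
noncomputable def linMatrixPoly (L : σ → Matrix (Fin a) (Fin b) K) :
    Matrix (Fin a) (Fin b) (MvPolynomial σ K) :=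
  Matrix.of fun i j => linForm fun k => L k i j

theorem eval_maxMinor (L : σ → Matrix (Fin a) (Fin (a + 1)) K) (s : σ → K) (i : Fin (a + 1)) :
    eval s (maxMinor (linMatrixPoly L) i) = maxMinor (linMatrix L s) i := by
  rw [maxMinor, maxMinor, RingHom.map_det]
  congr 1
  ext r c
  refine Fin.cases ?_ (fun r => ?_) r
  · by_cases h : c = i
    · subst h; simp
    · simp [h]
  · simp [linMatrixPoly, linMatrix]

/-- In each term of the Leibniz expansion the bordering row has degree zero and the other `a` rows
have degree one. -/
theorem isHomogeneous_maxMinor (L : σ → Matrix (Fin a) (Fin (a + 1)) K) (i : Fin (a + 1)) :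
    (maxMinor (linMatrixPoly L) i).IsHomogeneous a := by
  rw [maxMinor, ← Matrix.det_transpose, Matrix.det_apply]
  refine IsHomogeneous.sum _ _ _ fun g _ => ?_
  rw [← mem_homogeneousSubmodule]
  refine Submodule.smul_of_tower_mem _ _ ?_
  rw [mem_homogeneousSubmodule, Fin.prod_univ_succ]
  have h0 : ((bordered (Pi.single i 1) (linMatrixPoly L)).transpose (g 0) 0).IsHomogeneous 0 := by
    simp only [Matrix.transpose_apply, bordered_zero, Pi.single_apply]
    split_ifs
    · exact isHomogeneous_one _ _
    · exact isHomogeneous_zero _ _ _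
  have h1 : (∏ r : Fin a, (bordered (Pi.single i 1) (linMatrixPoly L)).transpose
      (g r.succ) r.succ).IsHomogeneous a := by
    have := IsHomogeneous.prod (Finset.univ : Finset (Fin a))
      (fun r => linForm fun k => L k r (g r.succ)) (fun _ => 1)
      fun r _ => isHomogeneous_linForm _
    simpa [linMatrixPoly] using this
  have h2 := h0.mul h1
  rwa [zero_add] at h2

end Pencil

section Degeneracy

variable {K : Type*} [Field K] [IsAlgClosed K] {ι : Type*} [Finite ι]

/-- If an `a × (a + 1)` matrix of linear forms in three variables degenerates only at finitely
many points of the plane, then its maximal minors have no common factor. -/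
theorem isUnit_of_dvd_maxMinor [Nonempty ι] {a : ℕ} (L : Fin 3 → Matrix (Fin a) (Fin (a + 1)) K)
    (p : ι → Fin 3 → K)
    (hall : ∀ s, s ≠ 0 → ∀ l, l ≠ 0 → Matrix.vecMul l (linMatrix L s) = 0 →
      ∃ i, s ∈ Submodule.span K {p i})
    (c : MvPolynomial (Fin 3) K) (hc : ∀ i, c ∣ maxMinor (linMatrixPoly L) i) : IsUnit c := by
  classical
  by_contra hcu
  obtain ⟨b, hb⟩ := exists_direction_of_not_isUnit hcu
  have : Infinite K := IsAlgClosed.instInfinite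
  -- Finitely many subspaces of dimension at most two cannot cover `K ^ 3`. From such an `x`, the
  -- line of direction `b` avoids all the degeneracy points, yet it meets the zero set of `c`, where
  -- every minor vanishes.
  obtain ⟨x, hx⟩ : ∃ x : Fin 3 → K, ∀ i, x ∉ Submodule.span K {p i, b} := by
    by_contra! hcon
    obtain ⟨i, hi⟩ := Subspace.exists_eq_top_of_iUnion_eq_univ
      (p := fun i => Submodule.span K {p i, b}) (Set.eq_univ_of_forall fun x => by
        obtain ⟨i, hi⟩ := hcon x
        exact Set.mem_iUnion.2 ⟨i, hi⟩)
    have h1 := finrank_span_finset_le_card (R := K) {p i, b}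
    rw [Set.finrank, Finset.coe_pair, hi, finrank_top, Module.finrank_fin_fun] at h1
    have h2 := Finset.card_le_two (a := p i) (b := b)
    lia
  obtain ⟨t, ht⟩ := hb x
  have hne : ∀ i, x + t • b ∉ Submodule.span K {p i, b} := fun i h => hx i <| by
    have h2 := Submodule.sub_mem _ h (Submodule.smul_mem _ t
      (Submodule.subset_span (Set.mem_insert_of_mem (p i) rfl)))
    rwa [add_sub_cancel_right] at h2
  have hmin : ∀ i, maxMinor (linMatrix L (x + t • b)) i = 0 := by
    intro i
    obtain ⟨d, hd⟩ := hc i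
    rw [← eval_maxMinor, hd, map_mul, ht, zero_mul]
  obtain ⟨l, hl, hl0⟩ := exists_vecMul_eq_zero_of_maxMinor_eq_zero hmin
  obtain ⟨i, hi⟩ := hall _ (fun h => hne (Classical.arbitrary ι) (by rw [h]; exact zero_mem _)) l hl hl0
  exact hne i (Submodule.span_mono (by simp) hi)

end Degeneracy

theorem homogeneousComponent_mul_of_isHomogeneous {σ R : Type*} [CommRing R] {e : ℕ}
    {f : MvPolynomial σ R} (hf : f.IsHomogeneous e) (a : MvPolynomial σ R) (n : ℕ) :
    homogeneousComponent (n + e) (a * f) = homogeneousComponent n a * f := by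
  conv_lhs => rw [← sum_homogeneousComponent a, Finset.sum_mul, map_sum]
  have h : ∀ i, homogeneousComponent (n + e) (homogeneousComponent i a * f) =
      if n = i then homogeneousComponent i a * f else 0 := by
    intro i
    rw [homogeneousComponent_of_mem ((homogeneousComponent_isHomogeneous i a).mul hf)]
    simp
  rw [Finset.sum_congr rfl fun i _ => h i, Finset.sum_ite_eq]
  split_ifs with hn
  · rfl
  · rw [homogeneousComponent_eq_zero _ _ (by simpa using hn), zero_mul]

/-! ### Vectors of forms: syzygies and separating functionals -/

section Forms

variable {K σ : Type*} [Field K] {a b : ℕ}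

/-- The functional `f ↦ l · f(p)` on vectors of forms. -/
noncomputable def evalFunctional (d : ℕ) (p : σ → K) (l : Fin a → K) :
    (Fin a → homogeneousSubmodule σ K d) →ₗ[K] K :=
  ∑ r, l r • ((aeval p : MvPolynomial σ K →ₐ[K] K).toLinearMap ∘ₗ Submodule.subtype _ ∘ₗ
    LinearMap.proj r)

theorem evalFunctional_apply (d : ℕ) (p : σ → K) (l : Fin a → K)
    (f : Fin a → homogeneousSubmodule σ K d) :
    evalFunctional d p l f = ∑ r, l r * eval p (f r : MvPolynomial σ K) := by
  simp [evalFunctional, aeval_eq_eval]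

/-- The vector of forms `w · H`. -/
noncomputable def constMul {d : ℕ} (w : Fin a → K) {H : MvPolynomial σ K}
    (hH : H.IsHomogeneous d) : Fin a → homogeneousSubmodule σ K d :=
  fun r => w r • ⟨H, hH⟩

theorem evalFunctional_constMul {d : ℕ} (p : σ → K) (l w : Fin a → K) {H : MvPolynomial σ K}
    (hH : H.IsHomogeneous d) :
    evalFunctional d p l (constMul w hH) = (l ⬝ᵥ w) * eval p H := by
  simp [evalFunctional_apply, constMul, dotProduct, Finset.sum_mul, smul_eval, mul_assoc]

variable [Fintype σ]

/-- Multiplication by a matrix of linear forms, on vectors of forms of degree `d`. -/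
noncomputable def mulLinMatrix (L : σ → Matrix (Fin a) (Fin b) K) (d : ℕ) :
    (Fin b → homogeneousSubmodule σ K d) →ₗ[K] (Fin a → homogeneousSubmodule σ K (d + 1)) :=
  LinearMap.pi fun r => LinearMap.codRestrict _
    (∑ j, LinearMap.mulLeft K (linMatrixPoly L r j) ∘ₗ Submodule.subtype _ ∘ₗ LinearMap.proj j)
    fun g => by
      rw [LinearMap.sum_apply]
      refine Submodule.sum_mem _ fun j _ => ?_
      rw [add_comm]
      exact (isHomogeneous_linForm _).mul (g j).2

theorem coe_mulLinMatrix_apply (L : σ → Matrix (Fin a) (Fin b) K) (d : ℕ)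
    (g : Fin b → homogeneousSubmodule σ K d) (r : Fin a) :
    (mulLinMatrix L d g r : MvPolynomial σ K) = ∑ j, linMatrixPoly L r j * (g j : MvPolynomial σ K) := by
  simp [mulLinMatrix]

/-- Multiples of the vector of maximal minors. -/
noncomputable def mulMaxMinor (L : σ → Matrix (Fin a) (Fin (a + 1)) K) (d : ℕ) :
    homogeneousSubmodule σ K d →ₗ[K] (Fin (a + 1) → homogeneousSubmodule σ K (d + a)) :=
  LinearMap.pi fun j => LinearMap.codRestrict _
    (LinearMap.mulRight K (maxMinor (linMatrixPoly L) j) ∘ₗ Submodule.subtype _)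
    fun h => h.2.mul (isHomogeneous_maxMinor L j)

/-- The exactness half of Hilbert–Burch: a syzygy is proportional to the vector of minors, hence a
multiple of it when these have no common factor. The multiplier may be replaced by its component of
degree `d`. This bounds the kernel by the space of forms of degree `d`. -/
theorem ker_mulLinMatrix_le (L : σ → Matrix (Fin a) (Fin (a + 1)) K)
    (hL : ∀ c, (∀ i, c ∣ maxMinor (linMatrixPoly L) i) → IsUnit c) (d : ℕ) :
    LinearMap.ker (mulLinMatrix L (d + a)) ≤ LinearMap.range (mulMaxMinor L d) := by
  intro g hg
  rw [LinearMap.mem_ker] at hg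
  have h1 : (linMatrixPoly L).mulVec (fun j => (g j : MvPolynomial σ K)) = 0 := by
    ext1 r
    have := congrArg (fun x : Fin a → homogeneousSubmodule σ K (d + a + 1) =>
      (x r : MvPolynomial σ K)) hg
    simpa [coe_mulLinMatrix_apply, Matrix.mulVec, dotProduct] using this
  obtain ⟨c, hc⟩ := exists_eq_mul_of_proportional (maxMinor (linMatrixPoly L))
    (fun j => (g j : MvPolynomial σ K)) (maxMinor_mul_eq_of_mulVec_eq_zero h1) hL
  refine ⟨⟨homogeneousComponent d c, homogeneousComponent_isHomogeneous d c⟩, ?_⟩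
  ext1 j
  apply Subtype.ext
  change homogeneousComponent d c * maxMinor (linMatrixPoly L) j = g j
  rw [← homogeneousComponent_mul_of_isHomogeneous (isHomogeneous_maxMinor L j), ← hc]
  exact homogeneousComponent_eq_self (g j).2

/-- The functional `f ↦ l · ∂ₜ f(p)` on vectors of forms. -/
noncomputable def derivFunctional (d : ℕ) (p t : σ → K) (l : Fin a → K) :
    (Fin a → homogeneousSubmodule σ K d) →ₗ[K] K :=
  ∑ r, l r • (dirDeriv p t ∘ₗ Submodule.subtype _ ∘ₗ LinearMap.proj r)

theorem derivFunctional_apply (d : ℕ) (p t : σ → K) (l : Fin a → K)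
    (f : Fin a → homogeneousSubmodule σ K d) :
    derivFunctional d p t l f = ∑ r, l r * dirDeriv p t (f r : MvPolynomial σ K) := by
  simp [derivFunctional]

theorem evalFunctional_mulLinMatrix (L : σ → Matrix (Fin a) (Fin b) K) (d : ℕ) (p : σ → K)
    (l : Fin a → K) (g : Fin b → homogeneousSubmodule σ K d) :
    evalFunctional (d + 1) p l (mulLinMatrix L d g) =
      ∑ j, Matrix.vecMul l (linMatrix L p) j * eval p (g j : MvPolynomial σ K) := by
  simp only [evalFunctional_apply, coe_mulLinMatrix_apply, map_sum, map_mul, Matrix.vecMul,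
    dotProduct, Finset.mul_sum, Finset.sum_mul]
  rw [Finset.sum_comm]
  refine Finset.sum_congr rfl fun j _ => Finset.sum_congr rfl fun r _ => ?_
  simp only [linMatrixPoly, linMatrix, Matrix.of_apply, eval_linForm]
  simp only [Finset.mul_sum, Finset.sum_mul, mul_assoc]

/-- By the Leibniz rule: when `l` kills `L(p)` the second sum disappears, and adding
`evalFunctional` at `ν` leaves the tangency expression `l L(t) + ν L(p)` paired with `g(p)`. -/
theorem derivFunctional_mulLinMatrix (L : σ → Matrix (Fin a) (Fin b) K) (d : ℕ) (p t : σ → K)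
    (l : Fin a → K) (g : Fin b → homogeneousSubmodule σ K d) :
    derivFunctional (d + 1) p t l (mulLinMatrix L d g) =
      ∑ j, Matrix.vecMul l (linMatrix L t) j * eval p (g j : MvPolynomial σ K) +
      ∑ j, Matrix.vecMul l (linMatrix L p) j * dirDeriv p t (g j : MvPolynomial σ K) := by
  simp only [derivFunctional_apply, coe_mulLinMatrix_apply, map_sum, dirDeriv_mul, Matrix.vecMul,
    dotProduct, Finset.sum_add_distrib, mul_add, Finset.mul_sum, Finset.sum_mul]
  congr 1 <;>
  · rw [Finset.sum_comm]
    refine Finset.sum_congr rfl fun j _ => Finset.sum_congr rfl fun r _ => ?_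
    simp only [linMatrixPoly, linMatrix, Matrix.of_apply, eval_linForm, dirDeriv_linForm]
    simp only [Finset.mul_sum, Finset.sum_mul, mul_assoc]

theorem derivFunctional_constMul {d : ℕ} (p t : σ → K) (l w : Fin a → K) {H : MvPolynomial σ K}
    (hH : H.IsHomogeneous d) :
    derivFunctional d p t l (constMul w hH) = (l ⬝ᵥ w) * dirDeriv p t H := by
  simp [derivFunctional_apply, constMul, dotProduct, Finset.sum_mul, mul_assoc]

theorem exists_dotProduct_ne_zero {l : Fin a → K} (hl : l ≠ 0) : ∃ w, l ⬝ᵥ w ≠ 0 := by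
  obtain ⟨r, hr⟩ := Function.ne_iff.1 hl
  exact ⟨Pi.single r 1, by simpa using hr⟩

/-- Forms of degree `2n` that separate `n` points of a projective space to the first order at
all the points but one. -/
theorem exists_separating_form {n : ℕ} (p : Fin n → σ → K)
    (hp0 : ∀ i, p i ≠ 0) (hp : ∀ i j, i ≠ j → p i ∉ Submodule.span K {p j}) (i : Fin n) :
    ∃ (H : MvPolynomial σ K), H.IsHomogeneous (2 * n) ∧ eval (p i) H = 1 ∧
      (∀ j, j ≠ i → eval (p j) H = 0) ∧ (∀ j, j ≠ i → ∀ t, dirDeriv (p j) t H = 0) ∧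
      ∀ t ∉ Submodule.span K {p i}, ∃ H' : MvPolynomial σ K, H'.IsHomogeneous (2 * n) ∧
        (∀ j, eval (p j) H' = 0) ∧ dirDeriv (p i) t H' = 1 := by
  classical
  have hm : ∀ j, ∃ m : σ → K, (j ≠ i → eval (p j) (linForm m) = 0) ∧
      eval (p i) (linForm m) = 1 := by
    intro j
    by_cases hj : j = i
    · obtain ⟨m, -, hm⟩ := exists_linForm_of_notMem_span (x := p i) (y := 0)
        (by simpa using hp0 i)
      exact ⟨m, fun h => absurd hj h, hm⟩
    · obtain ⟨m, hm⟩ := exists_linForm_of_notMem_span (hp i j (Ne.symm hj))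
      exact ⟨m, fun _ => hm.1, hm.2⟩
  choose m hmj hmi using hm
  have hn : (Finset.univ.erase i).card + 1 = n := by
    rw [Finset.card_erase_of_mem (Finset.mem_univ i), Finset.card_univ, Fintype.card_fin]
    have := i.pos
    lia
  -- The squares make `B` vanish to second order at the other `n - 1` points. Two linear factors
  -- remain to be chosen: a square for value one at `p i`, or a form `m'` vanishing at `p i` but not
  -- at `t` for a prescribed derivative.
  let B : MvPolynomial σ K := ∏ j ∈ Finset.univ.erase i, linForm (m j) ^ 2
  have hB : B.IsHomogeneous (2 * (Finset.univ.erase i).card) := by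
    have := IsHomogeneous.prod (Finset.univ.erase i) (fun j => linForm (m j) ^ 2) (fun _ => 1 * 2)
      fun j _ => (isHomogeneous_linForm (m j)).pow 2
    rw [Finset.sum_const, smul_eq_mul, one_mul, mul_comm] at this
    exact this
  have hBi : eval (p i) B = 1 := by
    simp only [B, map_prod, map_pow, hmi, one_pow, Finset.prod_const_one]
  have hBj : ∀ j, j ≠ i → ∃ B', B = linForm (m j) ^ 2 * B' := fun j hj =>
    ⟨_, (Finset.mul_prod_erase _ _ (Finset.mem_erase.2 ⟨hj, Finset.mem_univ j⟩)).symm⟩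
  refine ⟨B * linForm (m i) ^ 2, ?_, ?_, ?_, ?_, ?_⟩
  · convert hB.mul ((isHomogeneous_linForm (m i)).pow 2) using 1
    lia
  · rw [map_mul, map_pow, hBi, hmi]; simp
  · intro j hj
    obtain ⟨B', hB'⟩ := hBj j hj
    rw [hB', map_mul, map_mul, map_pow, hmj j hj]; simp
  · intro j hj t
    obtain ⟨B', hB'⟩ := hBj j hj
    rw [hB', mul_assoc]
    exact dirDeriv_sq_mul_eq_zero _ _ (hmj j hj) _
  · intro t ht
    obtain ⟨m', hm'p, hm't⟩ := exists_linForm_of_notMem_span ht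
    refine ⟨B * (linForm m' * linForm (m i)), ?_, ?_, ?_⟩
    · convert hB.mul ((isHomogeneous_linForm m').mul (isHomogeneous_linForm (m i))) using 1
      lia
    · intro j
      by_cases hj : j = i
      · subst hj
        rw [map_mul, map_mul, hm'p]; simp
      · obtain ⟨B', hB'⟩ := hBj j hj
        rw [hB', map_mul, map_mul, map_pow, hmj j hj]; simp
    · rw [eval_linForm] at hm't
      rw [dirDeriv_mul, dirDeriv_mul, dirDeriv_linForm, map_mul, hm'p, hBi, hmi, hm't]
      simp

/-- Evaluations at distinct points, together with a further functional of first order at one of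
them, are linearly independent on vectors of forms of large degree. -/
theorem linearIndependent_functionals {n : ℕ} (p : Fin n → σ → K)
    (hp0 : ∀ i, p i ≠ 0) (hp : ∀ i j, i ≠ j → p i ∉ Submodule.span K {p j})
    (l : Fin n → Fin a → K) (hl : ∀ i, l i ≠ 0) (i₀ : Fin n) (t : σ → K) (ν : Fin a → K)
    (hcase : t ∉ Submodule.span K {p i₀} ∨ t = 0 ∧ ν ∉ Submodule.span K {l i₀}) :
    LinearIndependent K (fun o : Option (Fin n) => o.elim
      (derivFunctional (2 * n) (p i₀) t (l i₀) + evalFunctional (2 * n) (p i₀) ν)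
      fun i => evalFunctional (2 * n) (p i) (l i)) := by
  classical
  rw [Fintype.linearIndependent_iff]
  intro c hc
  -- The relation is tested on `w · H` for separating forms `H`: this removes first the other
  -- points, then the extra functional, and last the evaluation at `p i₀`.
  have key : ∀ (w : Fin a → K) (H : MvPolynomial σ K), H.IsHomogeneous (2 * n) →
      c none * ((l i₀ ⬝ᵥ w) * dirDeriv (p i₀) t H + (ν ⬝ᵥ w) * eval (p i₀) H) +
        ∑ i, c (some i) * ((l i ⬝ᵥ w) * eval (p i) H) = 0 := by
    intro w H hH
    have h := congrArg (fun φ => φ (constMul w hH)) hc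
    simpa [Fintype.sum_option, evalFunctional_constMul, derivFunctional_constMul, mul_add] using h
  choose H hHd hH1 hH0 hHt hH' using exists_separating_form p hp0 hp
  have h1 : ∀ i, i ≠ i₀ → c (some i) = 0 := by
    intro i hi
    obtain ⟨w, hw⟩ := exists_dotProduct_ne_zero (hl i)
    have h := key w (H i) (hHd i)
    rw [hHt i i₀ (Ne.symm hi), hH0 i i₀ (Ne.symm hi), Finset.sum_eq_single i
      (fun j _ hj => by rw [hH0 i j hj]; ring) (by simp), hH1] at h
    simpa [hw] using h
  have h2 : c none = 0 := by
    rcases hcase with ht | ⟨rfl, hν⟩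
    · obtain ⟨H', hd', h0', h1'⟩ := hH' i₀ t ht
      obtain ⟨w, hw⟩ := exists_dotProduct_ne_zero (hl i₀)
      have h := key w H' hd'
      rw [Finset.sum_eq_zero (fun j _ => by rw [h0' j]; ring), h0', h1'] at h
      simpa [hw] using h
    · by_contra hne
      -- With `t = 0` the relation at `p i₀` reads `c none • ν + c (some i₀) • l i₀ = 0`, so `c none
      -- ≠ 0` would make `ν` a multiple of `l i₀`.
      refine hν (Submodule.mem_span_singleton.2 ⟨-(c none)⁻¹ * c (some i₀), ?_⟩)
      ext r
      have h := key (Pi.single r 1) (H i₀) (hHd i₀)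
      rw [Finset.sum_eq_single i₀ (fun j _ hj => by rw [hH0 i₀ j hj]; ring) (by simp), hH1] at h
      simp only [dirDeriv_apply, Pi.zero_apply, zero_mul, Finset.sum_const_zero, mul_zero,
        dotProduct_single, mul_one, zero_add] at h
      rw [Pi.smul_apply, smul_eq_mul]
      field_simp
      linear_combination -h
  have h3 : c (some i₀) = 0 := by
    obtain ⟨w, hw⟩ := exists_dotProduct_ne_zero (hl i₀)
    have h := key w (H i₀) (hHd i₀)
    rw [h2, zero_mul, zero_add, Finset.sum_eq_single i₀
      (fun j _ hj => by rw [hH0 i₀ j hj]; ring) (by simp), hH1] at h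
    simpa [hw] using h
  rintro (_ | i)
  · exact h2
  · by_cases hi : i = i₀
    · rw [hi]; exact h3
    · exact h1 i hi

end Forms

/-! ### Reducedness of a degeneracy locus of ten points -/

section Pencil

variable {K : Type*} [Field K] [IsAlgClosed K]

/-- If a `4 × 5` matrix of linear forms in three variables has exactly ten degeneracy points in
the plane, then there is no further first order condition at any of them: the degeneracy scheme
is reduced and the rank drops only by one. -/
theorem mem_span_of_tangent (L : Fin 3 → Matrix (Fin 4) (Fin 5) K) (p : Fin 10 → Fin 3 → K)
    (hp0 : ∀ i, p i ≠ 0) (hp : ∀ i j, i ≠ j → p i ∉ Submodule.span K {p j})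
    (hdeg : ∀ i, ∃ l, l ≠ 0 ∧ Matrix.vecMul l (linMatrix L (p i)) = 0)
    (hall : ∀ s, s ≠ 0 → ∀ l, l ≠ 0 → Matrix.vecMul l (linMatrix L s) = 0 →
      ∃ i, s ∈ Submodule.span K {p i})
    (i₀ : Fin 10) (l : Fin 4 → K) (hl : l ≠ 0) (hlL : Matrix.vecMul l (linMatrix L (p i₀)) = 0)
    (t : Fin 3 → K) (ν : Fin 4 → K)
    (htan : Matrix.vecMul l (linMatrix L t) + Matrix.vecMul ν (linMatrix L (p i₀)) = 0) :
    t ∈ Submodule.span K {p i₀} ∧ ν ∈ Submodule.span K {l} := by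
  classical
  choose l' hl'0 hl' using hdeg
  have core : ∀ t ν, Matrix.vecMul l (linMatrix L t) + Matrix.vecMul ν (linMatrix L (p i₀)) = 0 →
      ¬ (t ∉ Submodule.span K {p i₀} ∨ t = 0 ∧ ν ∉ Submodule.span K {l}) := by
    intro t ν htan hcase
    -- The tangency condition refers to the given `l`, so `l` has to be the kernel vector used at `p
    -- i₀`.
    let q : Fin 10 → Fin 4 → K := Function.update l' i₀ l
    have hq0 : ∀ i, q i ≠ 0 := by
      intro i
      by_cases hi : i = i₀
      · subst hi; simpa [q] using hl
      · simpa [q, hi] using hl'0 i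
    have hq : ∀ i, Matrix.vecMul (q i) (linMatrix L (p i)) = 0 := by
      intro i
      by_cases hi : i = i₀
      · subst hi; simpa [q] using hlL
      · simpa [q, hi] using hl' i
    have hqi : q i₀ = l := by simp [q]
    have hli := linearIndependent_functionals p hp0 hp q hq0 i₀ t ν (by rwa [hqi])
    have hann : ∀ o : Option (Fin 10), (o.elim
        (derivFunctional 20 (p i₀) t (q i₀) + evalFunctional 20 (p i₀) ν)
        fun i => evalFunctional 20 (p i) (q i)) ∈
        (LinearMap.range (mulLinMatrix L 19)).dualAnnihilator := by
      intro o
      rw [Submodule.mem_dualAnnihilator]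
      rintro _ ⟨g, rfl⟩
      rcases o with _ | i
      · change derivFunctional (19 + 1) (p i₀) t (q i₀) (mulLinMatrix L 19 g) +
          evalFunctional (19 + 1) (p i₀) ν (mulLinMatrix L 19 g) = 0
        rw [derivFunctional_mulLinMatrix, evalFunctional_mulLinMatrix, hq]
        simp only [Pi.zero_apply, zero_mul, Finset.sum_const_zero, add_zero]
        rw [← Finset.sum_add_distrib]
        refine Finset.sum_eq_zero fun j _ => ?_
        rw [← add_mul, hqi, ← Pi.add_apply, htan, Pi.zero_apply, zero_mul]
      · change evalFunctional (19 + 1) (p i) (q i) (mulLinMatrix L 19 g) = 0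
        rw [evalFunctional_mulLinMatrix, hq]
        simp
    have hfin : ∀ d, FiniteDimensional K (homogeneousSubmodule (Fin 3) K d) := fun d =>
      Module.Finite.iff_fg.2 (homogeneousSubmodule_fg _ _ d)
    have hcard : 11 ≤ Module.finrank K (LinearMap.range (mulLinMatrix L 19)).dualAnnihilator := by
      have h1 : LinearIndependent K (fun o : Option (Fin 10) =>
          (⟨_, hann o⟩ : (LinearMap.range (mulLinMatrix L 19)).dualAnnihilator)) :=
        LinearIndependent.of_comp (Submodule.subtype _) hli
      simpa using h1.fintype_card_le_finrank
    have hd15 : Module.finrank K (homogeneousSubmodule (Fin 3) K 15) = 136 := by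
      rw [finrank_homogeneousSubmodule]; decide
    have hd19 : Module.finrank K (homogeneousSubmodule (Fin 3) K 19) = 210 := by
      rw [finrank_homogeneousSubmodule]; decide
    have hd20 : Module.finrank K (homogeneousSubmodule (Fin 3) K (19 + 1)) = 231 := by
      rw [finrank_homogeneousSubmodule]; decide
    have h1 := Subspace.finrank_add_finrank_dualAnnihilator_eq
      (LinearMap.range (mulLinMatrix L 19))
    have h2 := LinearMap.finrank_range_add_finrank_ker (mulLinMatrix L 19)
    have h3 : Module.finrank K (LinearMap.ker (mulLinMatrix L (15 + 4))) ≤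
        Module.finrank K (LinearMap.range (mulMaxMinor L 15)) :=
      Submodule.finrank_mono (ker_mulLinMatrix_le L (isUnit_of_dvd_maxMinor L p hall) 15)
    have h4 := LinearMap.finrank_range_le (mulMaxMinor L 15)
    rw [Module.finrank_pi_fintype] at h1 h2
    simp only [Finset.sum_const, Finset.card_univ, Fintype.card_fin, smul_eq_mul, hd20, hd19] at h1 h2
    rw [hd15] at h4
    -- The annihilator of the image has dimension at most `4·231 - (5·210 - 136) = 10`, against the
    -- eleven independent functionals.
    lia
  have ht : t ∈ Submodule.span K {p i₀} := by
    by_contra h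
    exact core t ν htan (Or.inl h)
  refine ⟨ht, ?_⟩
  by_contra h
  obtain ⟨c, rfl⟩ := Submodule.mem_span_singleton.1 ht
  have h1 : linMatrix L (c • p i₀) = c • linMatrix L (p i₀) := by
    ext i j
    simp only [linMatrix, Matrix.of_apply, Matrix.smul_apply, Pi.smul_apply, smul_eq_mul,
      Finset.mul_sum]
    exact Finset.sum_congr rfl fun k _ => by ring
  have h0 : linMatrix L 0 = 0 := by
    ext i j
    simp [linMatrix]
  -- Once `t` is a multiple of `p i₀`, its term vanishes and `(0, ν)` is itself a deformation.
  rw [h1, Matrix.vecMul_smul, hlL, smul_zero, zero_add] at htan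
  exact core 0 ν (by rw [h0, Matrix.vecMul_zero, htan, add_zero]) (Or.inr ⟨rfl, h⟩)

end Pencil

/-! ### Quadratic forms and their polar forms -/

section Quadratic

variable {σ K : Type*} [Fintype σ] [Field K]

theorem exists_quadratic_coefficients {F : MvPolynomial σ K} (hF : F.IsHomogeneous 2) :
    ∃ B : σ → σ → K, F = ∑ i, ∑ j, C (B i j) * (X i * X j) := by
  have hlin : ∀ m ∈ homogeneousSubmodule σ K 1, ∃ u : σ → K, m = linForm u := by
    intro m hm
    rw [homogeneousSubmodule_one_eq_span_X, Submodule.mem_span_range_iff_exists_fun] at hm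
    obtain ⟨u, rfl⟩ := hm
    exact ⟨u, Finset.sum_congr rfl fun i _ => smul_eq_C_mul _ _⟩
  have h1 : F ∈ homogeneousSubmodule σ K 1 * homogeneousSubmodule σ K 1 := by
    rw [← pow_two, homogeneousSubmodule_one_pow]
    exact hF
  refine Submodule.mul_induction_on h1 ?_ ?_
  · intro m hm n hn
    obtain ⟨u, rfl⟩ := hlin m hm
    obtain ⟨w, rfl⟩ := hlin n hn
    refine ⟨fun i j => u i * w j, ?_⟩
    simp only [linForm, Finset.sum_mul_sum, C_mul]
    exact Finset.sum_congr rfl fun i _ => Finset.sum_congr rfl fun j _ => by ring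
  · rintro _ _ ⟨B, rfl⟩ ⟨B', rfl⟩
    exact ⟨fun i j => B i j + B' i j, by simp only [C_add, add_mul, Finset.sum_add_distrib]⟩

/-- The differential of a polynomial at a point, as a linear form. -/
noncomputable def diffAt (F : MvPolynomial σ K) (x : σ → K) : (σ → K) →ₗ[K] K where
  toFun y := dirDeriv x y F
  map_add' y z := by simp only [dirDeriv_apply, Pi.add_apply, add_mul, Finset.sum_add_distrib]
  map_smul' c y := by
    simp only [dirDeriv_apply, Pi.smul_apply, smul_eq_mul, RingHom.id_apply, Finset.mul_sum,
      mul_assoc]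

theorem diffAt_apply (F : MvPolynomial σ K) (x y : σ → K) : diffAt F x y = dirDeriv x y F := rfl

/-- This identifies `diffAt` of a quadratic form with its polar form. Symmetry lets the base point
and the direction be exchanged, which turns derivatives along the plane into differentials at points
of the plane. -/
theorem eval_add_eq {F : MvPolynomial σ K} (hF : F.IsHomogeneous 2) (x y : σ → K) :
    eval (x + y) F = eval x F + eval y F + diffAt F x y := by
  classical
  obtain ⟨B, rfl⟩ := exists_quadratic_coefficients hF
  have h : diffAt (∑ i, ∑ j, C (B i j) * (X i * X j)) x y =
      ∑ i, ∑ j, B i j * (x i * y j + y i * x j) := by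
    rw [diffAt_apply, map_sum]
    refine Finset.sum_congr rfl fun i _ => ?_
    rw [map_sum]
    refine Finset.sum_congr rfl fun j _ => ?_
    have hX : ∀ i, dirDeriv x y (X i : MvPolynomial σ K) = y i := by
      intro i
      simp only [dirDeriv_apply, pderiv_X, Pi.single_apply]
      simp
    rw [← smul_eq_C_mul, map_smul, dirDeriv_mul, hX, hX, eval_X, eval_X, smul_eq_mul]
    ring
  rw [h]
  simp only [map_sum, map_mul, eval_C, eval_X, Pi.add_apply, ← Finset.sum_add_distrib]
  exact Finset.sum_congr rfl fun i _ => Finset.sum_congr rfl fun j _ => by ring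

theorem diffAt_comm {F : MvPolynomial σ K} (hF : F.IsHomogeneous 2) (x y : σ → K) :
    diffAt F x y = diffAt F y x := by
  have h1 := eval_add_eq hF x y
  have h2 := eval_add_eq hF y x
  rw [add_comm y x, h1] at h2
  linear_combination h2

theorem eval_smul_eq {F : MvPolynomial σ K} (hF : F.IsHomogeneous 2) (c : K) (x : σ → K) :
    eval (c • x) F = c ^ 2 * eval x F := by
  obtain ⟨B, rfl⟩ := exists_quadratic_coefficients hF
  simp only [map_sum, map_mul, eval_C, eval_X, Pi.smul_apply, smul_eq_mul, Finset.mul_sum]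
  exact Finset.sum_congr rfl fun i _ => Finset.sum_congr rfl fun j _ => by ring

theorem diffAt_self {F : MvPolynomial σ K} (hF : F.IsHomogeneous 2) (x : σ → K) :
    diffAt F x x = 2 * eval x F := by
  have h1 := eval_add_eq hF x x
  rw [← two_smul K x, eval_smul_eq hF] at h1
  linear_combination -h1

theorem diffAt_add_left {F : MvPolynomial σ K} (hF : F.IsHomogeneous 2) (x x' y : σ → K) :
    diffAt F (x + x') y = diffAt F x y + diffAt F x' y := by
  rw [diffAt_comm hF, map_add, diffAt_comm hF y, diffAt_comm hF y]

theorem diffAt_smul_left {F : MvPolynomial σ K} (hF : F.IsHomogeneous 2) (c : K) (x y : σ → K) :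
    diffAt F (c • x) y = c * diffAt F x y := by
  rw [diffAt_comm hF, map_smul, diffAt_comm hF y, smul_eq_mul]

theorem diffAt_eq_zero_of_mem {F : MvPolynomial σ K} (hF : F.IsHomogeneous 2)
    {W : Submodule K (σ → K)} (hW : ∀ x ∈ W, eval x F = 0) {x y : σ → K} (hx : x ∈ W)
    (hy : y ∈ W) : diffAt F x y = 0 := by
  have h := eval_add_eq hF x y
  rw [hW x hx, hW y hy, hW _ (W.add_mem hx hy)] at h
  linear_combination -h

theorem diffAt_sum_smul {ι : Type*} [Fintype ι] (c : ι → K) (Q : ι → MvPolynomial σ K)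
    (x y : σ → K) : diffAt (∑ i, c i • Q i) x y = ∑ i, c i * diffAt (Q i) x y := by
  simp only [diffAt_apply, map_sum, map_smul, smul_eq_mul]

/-- The polynomial of degree one defined by a linear form. -/
noncomputable def ofDual [DecidableEq σ] (f : (σ → K) →ₗ[K] K) : MvPolynomial σ K :=
  linForm fun k => f (Pi.single k 1)

theorem sum_apply_single_mul [DecidableEq σ] (f : (σ → K) →ₗ[K] K) (x : σ → K) :
    ∑ k, f (Pi.single k 1) * x k = f x := by
  conv_rhs => rw [← Finset.univ_sum_single x, map_sum]
  refine Finset.sum_congr rfl fun k _ => ?_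
  rw [mul_comm, ← smul_eq_mul, ← map_smul, ← Pi.single_smul, smul_eq_mul, mul_one]

@[simp]
theorem eval_ofDual [DecidableEq σ] (f : (σ → K) →ₗ[K] K) (x : σ → K) :
    eval x (ofDual f) = f x := by
  rw [ofDual, eval_linForm, sum_apply_single_mul]

@[simp]
theorem diffAt_ofDual [DecidableEq σ] (f : (σ → K) →ₗ[K] K) (x y : σ → K) :
    diffAt (ofDual f) x y = f y := by
  rw [diffAt_apply, ofDual, dirDeriv_linForm, sum_apply_single_mul]

theorem diffAt_mul (f g : MvPolynomial σ K) (x y : σ → K) :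
    diffAt (f * g) x y = diffAt f x y * eval x g + eval x f * diffAt g x y :=
  dirDeriv_mul x y f g

theorem sum_eval_pderiv_mul (f : MvPolynomial σ K) (x y : σ → K) :
    ∑ i, eval x (pderiv i f) * y i = diffAt f x y :=
  Finset.sum_congr rfl fun _ _ => mul_comm _ _

end Quadratic

/-! ### Completing systems of linear equations -/

section LinearAlgebra

variable {K V : Type*} [Field K] [AddCommGroup V] [Module K V]

/-- A system of independent linear equations which are satisfied on `W` extends to a system of
independent equations of `W`. -/
theorem exists_complete_equations [FiniteDimensional K V] {a b : ℕ} (W : Submodule K V) (Φ : V →ₗ[K] (Fin a → K))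
    (hΦ : Function.Surjective Φ) (hW : W ≤ LinearMap.ker Φ)
    (hdim : Module.finrank K W + a + b = Module.finrank K V) :
    ∃ T : V →ₗ[K] (Fin b → K), W ≤ LinearMap.ker T ∧
      (∀ x, Φ x = 0 → T x = 0 → x ∈ W) ∧ Function.Surjective (Φ.prod T) := by
  let U := LinearMap.ker Φ
  let W' : Submodule K U := W.comap U.subtype
  have hW' : Module.finrank K W' = Module.finrank K W :=
    (Submodule.comapSubtypeEquivOfLe hW).finrank_eq
  have hU := LinearMap.finrank_range_add_finrank_ker Φ
  rw [LinearMap.range_eq_top.2 hΦ, finrank_top, Module.finrank_fin_fun] at hU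
  have hq := Submodule.finrank_quotient_add_finrank W'
  have hdimq : Module.finrank K (U ⧸ W') = b := by
    change _ + _ = Module.finrank K (LinearMap.ker Φ) at hq
    lia
  let e : (U ⧸ W') ≃ₗ[K] (Fin b → K) := LinearEquiv.ofFinrankEq _ _ (by simp [hdimq])
  obtain ⟨T, hT⟩ := LinearMap.exists_extend (e.toLinearMap ∘ₗ W'.mkQ)
  have hTU : ∀ x (hx : x ∈ U), T x = e (W'.mkQ ⟨x, hx⟩) := fun x hx =>
    congrArg (fun f => f ⟨x, hx⟩) hT
  have hTW : W ≤ LinearMap.ker T := fun x hx => by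
    rw [LinearMap.mem_ker, hTU x (hW hx), Submodule.mkQ_apply,
      (Submodule.Quotient.mk_eq_zero W').2 (show (⟨x, hW hx⟩ : U) ∈ W' from hx), map_zero]
  have hTW' : ∀ x, Φ x = 0 → T x = 0 → x ∈ W := fun x hx hTx => by
    rw [hTU x hx, e.map_eq_zero_iff, Submodule.mkQ_apply, Submodule.Quotient.mk_eq_zero] at hTx
    exact hTx
  refine ⟨T, hTW, hTW', ?_⟩
  have hker : LinearMap.ker (Φ.prod T) = W := by
    rw [LinearMap.ker_prod]
    exact le_antisymm (fun x hx => hTW' x hx.1 hx.2) (le_inf hW hTW)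
  have hr := LinearMap.finrank_range_add_finrank_ker (Φ.prod T)
  rw [hker] at hr
  rw [← LinearMap.range_eq_top]
  apply Submodule.eq_top_of_finrank_eq
  rw [Module.finrank_prod, Module.finrank_fin_fun, Module.finrank_fin_fun]
  lia

theorem surjective_of_forall_sum_eq_zero {a : ℕ} (Φ : V →ₗ[K] (Fin a → K))
    (h : ∀ c : Fin a → K, (∀ x, ∑ k, c k * Φ x k = 0) → c = 0) : Function.Surjective Φ := by
  classical
  rw [← LinearMap.range_eq_top]
  by_contra hne
  obtain ⟨f, hf0, hf⟩ := Submodule.exists_le_ker_of_lt_top _ (lt_top_iff_ne_top.2 hne)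
  refine hf0 ?_
  have hc := h (fun k => f (Pi.single k 1)) fun x => by
    rw [sum_apply_single_mul]
    exact hf ⟨x, rfl⟩
  ext k
  simpa using congrFun hc k

end LinearAlgebra

/-! ### Local elimination near a singular point -/

section LocalEquations

variable {σ K : Type*} [Fintype σ] [DecidableEq σ] [Field K]

/-- A quadratic form that vanishes on the common kernel of linear forms is a combination of these
linear forms; on the common kernel, the coefficients are read off from the polar form. -/
theorem exists_linear_coefficients [CharZero K] {F : MvPolynomial σ K}
    (hF : F.IsHomogeneous 2) {ι : Type*} [Fintype ι] [DecidableEq ι]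
    (T : (σ → K) →ₗ[K] (ι → K)) (S : (ι → K) →ₗ[K] (σ → K)) (hTS : ∀ c, T (S c) = c)
    (hker : ∀ x, T x = 0 → eval x F = 0) :
    ∃ N : ι → ((σ → K) →ₗ[K] K),
      F = ∑ i, ofDual (LinearMap.proj i ∘ₗ T) * ofDual (N i) ∧
        ∀ x, T x = 0 → ∀ i, N i x = diffAt F x (S (Pi.single i 1)) := by
  let D : (σ → K) →ₗ[K] (σ → K) →ₗ[K] K := LinearMap.mk₂ K (fun x y => diffAt F x y)
    (fun x x' y => diffAt_add_left hF x x' y) (fun c x y => diffAt_smul_left hF c x y)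
    (fun x y y' => map_add _ y y') (fun c x y => map_smul _ c y)
  have hD : ∀ x y, D x y = diffAt F x y := fun _ _ => rfl
  -- With `B` the polar form, splitting `x = (x - S T x) + S T x` gives `F(x) = B(x - ½ S T x, S T
  -- x)`, because `F` vanishes on `ker T` and `B(y, y) = 2 F(y)`. Expanding `S T x` in the vectors
  -- `S eᵢ` yields `N i`.
  refine ⟨fun i => D.flip (S (Pi.single i 1)) ∘ₗ (LinearMap.id - (2⁻¹ : K) • (S ∘ₗ T)), ?_, ?_⟩
  · refine MvPolynomial.funext fun x => ?_
    have h1 : T (x - S (T x)) = 0 := by rw [map_sub, hTS, sub_self]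
    have h2 := eval_add_eq hF (x - S (T x)) (S (T x))
    rw [sub_add_cancel, hker _ h1, zero_add] at h2
    have h3 := diffAt_self hF (S (T x))
    have h4 : D (x - (2⁻¹ : K) • S (T x)) (S (T x)) = eval x F := by
      rw [h2, ← hD, map_sub, map_sub, LinearMap.sub_apply, LinearMap.sub_apply, map_smul,
        LinearMap.smul_apply, hD (S (T x)) (S (T x)), h3, smul_eq_mul]
      ring
    rw [← h4, map_sum]
    have h5 : ∀ f : (ι → K) →ₗ[K] K, f (T x) = ∑ i, f (Pi.single i (T x i)) := fun f => by
      rw [← map_sum, Finset.univ_sum_single]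
    rw [← LinearMap.comp_apply, h5]
    refine Finset.sum_congr rfl fun i _ => ?_
    rw [show (Pi.single i (T x i) : ι → K) = T x i • Pi.single i 1 by
      rw [← Pi.single_smul, smul_eq_mul, mul_one], map_smul, map_mul, eval_ofDual,
      eval_ofDual, smul_eq_mul]
    rfl
  · intro x hx i
    simp [hx, hD]

end LocalEquations

theorem sum_mul_eq_dotProduct {R α β : Type*} [CommRing R] [Fintype α] [Fintype β]
    (x y : α ⊕ β → R) : ∑ i, x i * y i =
      (fun i => y (Sum.inl i)) ⬝ᵥ (fun i => x (Sum.inl i)) +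
        (fun i => y (Sum.inr i)) ⬝ᵥ (fun i => x (Sum.inr i)) := by
  rw [Fintype.sum_sum_type, dotProduct_comm, dotProduct_comm fun i => y (Sum.inr i)]
  rfl

/-- Elimination in a system of equations `G = A t + B s`, `F = C · t + D · s`. -/
theorem det_mul_eq_of_system {R : Type*} [CommRing R] {a b : ℕ} (A : Matrix (Fin a) (Fin a) R)
    (B : Matrix (Fin a) (Fin b) R) (C : Fin a → R) (D : Fin b → R) (t : Fin a → R) (s : Fin b → R) :
    A.det * (C ⬝ᵥ t + D ⬝ᵥ s) =
      Matrix.vecMul C A.adjugate ⬝ᵥ (A.mulVec t + B.mulVec s) +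
        (A.det • D - Matrix.vecMul (Matrix.vecMul C A.adjugate) B) ⬝ᵥ s := by
  rw [dotProduct_add, ← Matrix.dotProduct_mulVec, Matrix.mulVec_mulVec, Matrix.adjugate_mul,
    Matrix.smul_mulVec, Matrix.one_mulVec, dotProduct_smul, sub_dotProduct,
    smul_dotProduct, ← Matrix.dotProduct_mulVec _ B]
  simp only [smul_eq_mul]
  ring

/-- Elimination of some of the equations of a linear space from a system of quadrics which contain
it, near a point `v` at which the differential of the last quadric `F` vanishes. -/
theorem exists_elimination {σ K : Type*} [Fintype σ] [DecidableEq σ] [Field K] [CharZero K]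
    {m n : ℕ} {G : Fin m → MvPolynomial σ K} {F : MvPolynomial σ K}
    (P : (σ → K) →ₗ[K] (Fin m ⊕ Fin n → K)) (S : (Fin m ⊕ Fin n → K) →ₗ[K] (σ → K))
    (hPS : ∀ c, P (S c) = c) (hG : ∀ k, (G k).IsHomogeneous 2) (hF : F.IsHomogeneous 2)
    (hGP : ∀ k x, P x = 0 → eval x (G k) = 0) (hFP : ∀ x, P x = 0 → eval x F = 0)
    {v : σ → K} (hPv : P v = 0) (hGv : ∀ k y, diffAt (G k) v y = P y (Sum.inl k))
    (hFv : ∀ y, diffAt F v y = 0) :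
    ∃ (δ : MvPolynomial σ K) (u : Fin m → MvPolynomial σ K) (a : Fin n → MvPolynomial σ K),
      δ * F = u ⬝ᵥ G + a ⬝ᵥ (fun c => ofDual (LinearMap.proj (Sum.inr c) ∘ₗ P)) ∧
      eval v δ = 1 ∧ (∀ c, eval v (a c) = 0) ∧
      ∀ c y, P y = 0 → diffAt (a c) v y = diffAt F y (S (Pi.single (Sum.inr c) 1)) := by
  classical
  choose NG hNG hNGW using fun k => exists_linear_coefficients (hG k) P S hPS (hGP k)
  obtain ⟨N, hN, hNW⟩ := exists_linear_coefficients hF P S hPS hFP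
  let A : Matrix (Fin m) (Fin m) (MvPolynomial σ K) :=
    Matrix.of fun k i => ofDual (NG k (Sum.inl i))
  let B : Matrix (Fin m) (Fin n) (MvPolynomial σ K) :=
    Matrix.of fun k c => ofDual (NG k (Sum.inr c))
  let c₁ : Fin m → MvPolynomial σ K := fun i => ofDual (N (Sum.inl i))
  let c₂ : Fin n → MvPolynomial σ K := fun c => ofDual (N (Sum.inr c))
  let t : Fin m → MvPolynomial σ K := fun i => ofDual (LinearMap.proj (Sum.inl i) ∘ₗ P)
  let s : Fin n → MvPolynomial σ K := fun c => ofDual (LinearMap.proj (Sum.inr c) ∘ₗ P)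
  have hFsys : c₁ ⬝ᵥ t + c₂ ⬝ᵥ s = F := (hN.trans (sum_mul_eq_dotProduct _ _)).symm
  have hGsys : A.mulVec t + B.mulVec s = G :=
    funext fun k => ((hNG k).trans (sum_mul_eq_dotProduct _ _)).symm
  let u : Fin m → MvPolynomial σ K := Matrix.vecMul c₁ A.adjugate
  let a : Fin n → MvPolynomial σ K := A.det • c₂ - Matrix.vecMul u B
  have hsys : A.det * F = u ⬝ᵥ G + a ⬝ᵥ s := by
    rw [← hFsys, ← hGsys]
    exact det_mul_eq_of_system A B c₁ c₂ t s
  have hGS : ∀ k i, diffAt (G k) v (S (Pi.single i 1)) = (Pi.single i 1 : Fin m ⊕ Fin n → K) (Sum.inl k) := by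
    intro k i
    rw [hGv, hPS]
  -- The first `m` equations are the differentials of `G` at `v`, so `A` is the identity and `B` is
  -- zero there. Hence `δ = det A` is one at `v`, and `a` agrees with `c₂` to first order, since the
  -- correction `u B` is a product of terms vanishing at `v`.
  have hA : A.map (eval v) = 1 := by
    ext k i
    rw [Matrix.map_apply, show A k i = ofDual (NG k (Sum.inl i)) from rfl, eval_ofDual, hNGW k v hPv, hGS, Matrix.one_apply]
    simp [Pi.single_apply]
  have hB : ∀ k c, eval v (B k c) = 0 := fun k c => by
    rw [show B k c = ofDual (NG k (Sum.inr c)) from rfl, eval_ofDual, hNGW k v hPv, hGS]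
    simp
  have hdet : eval v A.det = 1 := by
    rw [RingHom.map_det]
    change (A.map (eval v)).det = 1
    rw [hA, Matrix.det_one]
  have hc₁ : ∀ i, eval v (c₁ i) = 0 := fun i => by rw [eval_ofDual, hNW v hPv, hFv]
  have hc₂ : ∀ c, eval v (c₂ c) = 0 := fun c => by rw [eval_ofDual, hNW v hPv, hFv]
  have hu : ∀ k, eval v (u k) = 0 := fun k => by
    simp only [u, Matrix.vecMul, dotProduct, map_sum, map_mul, hc₁, zero_mul,
      Finset.sum_const_zero]
  have hac : ∀ c, a c = A.det * c₂ c - ∑ k, u k * B k c := fun c => rfl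
  have ha : ∀ c, eval v (a c) = 0 := fun c => by
    simp only [hac, map_sub, map_mul, map_sum, hc₂, hu, mul_zero, zero_mul,
      Finset.sum_const_zero, sub_zero]
  refine ⟨A.det, u, a, hsys, hdet, ha, fun c y hy => ?_⟩
  rw [← hNW y hy, hac, diffAt_apply, map_sub, map_sum]
  simp only [← diffAt_apply, diffAt_mul, hc₂, hu, hB, hdet, mul_zero, zero_mul,
    Finset.sum_const_zero, sub_zero, add_zero, zero_add, one_mul, c₂, diffAt_ofDual]

/-! ### The node in coordinates -/

/-- The equation of the node. -/
noncomputable def sumSq : MvPolynomial (Fin 4) ℂ := ∑ k, X k ^ 2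

theorem isHomogeneous_sumSq : sumSq.IsHomogeneous 2 :=
  IsHomogeneous.sum _ _ _ fun k _ => isHomogeneous_X_pow k 2

theorem coe_sumSq : (sumSq : MvPowerSeries (Fin 4) ℂ) =
    ∑ k : Fin 4, (MvPowerSeries.X k : MvPowerSeries (Fin 4) ℂ) ^ 2 := by
  simp [sumSq, Fin.sum_univ_four]

/-- A change of variables that takes the sum of four squares to `s₀ a₀ + s₁ a₁`. -/
noncomputable def hyperbolicCoordinates (s a : Fin 2 → MvPolynomial (Fin 8) ℂ) :
    Fin 4 → MvPolynomial (Fin 8) ℂ :=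
  ![(2⁻¹ : ℂ) • (s 0 + a 0), (Complex.I * 2⁻¹) • (s 0 - a 0),
    (2⁻¹ : ℂ) • (s 1 + a 1), (Complex.I * 2⁻¹) • (s 1 - a 1)]

theorem aeval_sumSq (s a : Fin 2 → MvPolynomial (Fin 8) ℂ) :
    aeval (hyperbolicCoordinates s a) sumSq = a ⬝ᵥ s := by
  have h : ∀ x y : MvPolynomial (Fin 8) ℂ,
      ((2⁻¹ : ℂ) • (x + y)) ^ 2 + ((Complex.I * 2⁻¹) • (x - y)) ^ 2 = y * x := by
    intro x y
    rw [smul_pow, smul_pow, mul_pow, Complex.I_sq, smul_eq_C_mul, smul_eq_C_mul]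
    have h4 : (C (4⁻¹ : ℂ) : MvPolynomial (Fin 8) ℂ) * 4 = 1 := by
      rw [show (4 : MvPolynomial (Fin 8) ℂ) = C 4 from (map_ofNat C 4).symm, ← C_mul]
      norm_num
    rw [show ((2⁻¹ : ℂ) ^ 2) = 4⁻¹ by norm_num, neg_one_mul, C_neg]
    linear_combination (x * y) * h4
  rw [sumSq, map_sum, Fin.sum_univ_four, dotProduct, Fin.sum_univ_two, ← h, ← h, add_assoc]
  simp only [map_pow, aeval_X]
  rfl

theorem eval_hyperbolicCoordinates {s a : Fin 2 → MvPolynomial (Fin 8) ℂ} {v : Fin 8 → ℂ}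
    (hs : ∀ c, eval v (s c) = 0) (ha : ∀ c, eval v (a c) = 0) (k : Fin 4) :
    eval v (hyperbolicCoordinates s a k) = 0 := by
  fin_cases k <;> simp [hyperbolicCoordinates, smul_eval, hs, ha]

theorem diffAt_hyperbolicCoordinates {s a : Fin 2 → MvPolynomial (Fin 8) ℂ} {v y : Fin 8 → ℂ}
    (h : ∀ k, diffAt (hyperbolicCoordinates s a k) v y = 0) (c : Fin 2) :
    diffAt (s c) v y = 0 ∧ diffAt (a c) v y = 0 := by
  have key : ∀ p q : MvPolynomial (Fin 8) ℂ, diffAt ((2⁻¹ : ℂ) • (p + q)) v y = 0 →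
      diffAt ((Complex.I * 2⁻¹) • (p - q)) v y = 0 → diffAt p v y = 0 ∧ diffAt q v y = 0 := by
    intro p q h1 h2
    simp only [diffAt_apply, map_smul, map_add, map_sub, smul_eq_mul, mul_eq_zero, inv_eq_zero,
      OfNat.ofNat_ne_zero, Complex.I_ne_zero, false_or] at h1 h2 ⊢
    exact ⟨by linear_combination (h1 + h2) / 2, by linear_combination (h1 - h2) / 2⟩
  fin_cases c
  · exact key _ _ (h 0) (h 1)
  · exact key _ _ (h 2) (h 3)

/-- Modulo `M ^ n`, `δ` is inverted by a finite geometric series: `1 - (1 - δ) ^ n` is a multiple of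
`δ`. Dividing by `δ` is therefore legitimate modulo each power of the ideal of the point, even
though `δ` need not be a unit among the polynomials. -/
theorem mem_of_mul_mem_sup {R : Type*} [CommRing R] {J M : Ideal R} {δ f : R}
    (hδ : 1 - δ ∈ M) (hf : δ * f ∈ J) (n : ℕ) : f ∈ J ⊔ M ^ n := by
  obtain ⟨s, hs⟩ := sub_dvd_pow_sub_pow 1 (1 - δ) n
  rw [sub_sub_cancel, one_pow] at hs
  have h1 := Ideal.add_mem _
    (Ideal.mem_sup_left (J.mul_mem_left s hf) : s * (δ * f) ∈ J ⊔ M ^ n)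
    (Ideal.mem_sup_right ((M ^ n).mul_mem_right f (Ideal.pow_mem_pow hδ n)))
  convert h1 using 1
  linear_combination f * hs

/-- An intersection of four quadrics through a linear space `W` of dimension three has a node at a
point `v` of `W`, if the only first order deformations of the linear relation `l` between the
differentials of the quadrics at `v`, along `W`, are the trivial ones. -/
theorem nonempty_completedLocalRing_algEquiv (Q : Fin 4 → MvPolynomial (Fin 8) ℂ)
    (hQ : ∀ i, (Q i).IsHomogeneous 2) (W : Submodule ℂ (Fin 8 → ℂ))
    (hW : Module.finrank ℂ W = 3) (hQW : ∀ i, ∀ x ∈ W, eval x (Q i) = 0)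
    {v : Fin 8 → ℂ} (hv : v ∈ W) {j : Fin 8} (hvj : v j = 1) {l : Fin 4 → ℂ} (hl : l ≠ 0)
    (hlv : ∀ y, ∑ i, l i * diffAt (Q i) v y = 0)
    (htan : ∀ t ∈ W, ∀ ν : Fin 4 → ℂ,
      (∀ y, ∑ i, l i * diffAt (Q i) t y + ∑ i, ν i * diffAt (Q i) v y = 0) →
      t ∈ Submodule.span ℂ {v} ∧ ν ∈ Submodule.span ℂ {l}) :
    Nonempty (CompletedLocalRing Q j v ≃ₐ[ℂ] NodeRing) := by
  classical
  obtain ⟨i₀, hi₀⟩ := Function.ne_iff.1 hl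
  rw [Pi.zero_apply] at hi₀
  let G : Fin 3 → MvPolynomial (Fin 8) ℂ := fun k => Q (i₀.succAbove k)
  let F : MvPolynomial (Fin 8) ℂ := ∑ i, l i • Q i
  have hF : F.IsHomogeneous 2 := IsHomogeneous.sum _ _ _ fun i _ => by
    rw [smul_eq_C_mul]; exact (hQ i).C_mul (l i)
  have hGW : ∀ k, ∀ x ∈ W, eval x (G k) = 0 := fun k => hQW _
  have hFW : ∀ x ∈ W, eval x F = 0 := fun x hx => by
    simp [F, smul_eval, hQW _ x hx]
  have hdF : ∀ x y, diffAt F x y = ∑ i, l i * diffAt (Q i) x y := fun x y =>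
    diffAt_sum_smul l Q x y
  have hFv : ∀ y, diffAt F v y = 0 := fun y => by rw [hdF, hlv]
  let Φ : (Fin 8 → ℂ) →ₗ[ℂ] (Fin 3 → ℂ) := LinearMap.pi fun k => diffAt (G k) v
  have hΦ : ∀ x k, Φ x k = diffAt (G k) v x := fun _ _ => rfl
  have hins : ∀ (c : Fin 3 → ℂ) y, ∑ i, (i₀.insertNth 0 c : Fin 4 → ℂ) i * diffAt (Q i) v y =
      ∑ k, c k * Φ y k := by
    intro c y
    rw [Fin.sum_univ_succAbove _ i₀]
    simp [hΦ, G]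
  have hΦs : Function.Surjective Φ := by
    refine surjective_of_forall_sum_eq_zero Φ fun c hc => ?_
    -- A relation among the differentials of `G` is a deformation with `t = 0`. Its entry at `i₀` is
    -- zero while `l i₀ ≠ 0`, so being a multiple of `l` it vanishes.
    have h1 := (htan 0 W.zero_mem (i₀.insertNth 0 c) fun y => by
      rw [hins, hc, add_zero, ← hdF, diffAt_comm hF, map_zero]).2
    obtain ⟨d, hd⟩ := Submodule.mem_span_singleton.1 h1
    have h2 : d = 0 := by
      have := congrFun hd i₀
      simpa [hi₀] using this
    ext k
    have := congrFun hd (i₀.succAbove k)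
    simpa [h2] using this.symm
  have hWΦ : W ≤ LinearMap.ker Φ := fun x hx => by
    rw [LinearMap.mem_ker]
    ext k
    exact diffAt_eq_zero_of_mem (hQ _) (hQW _) hv hx
  obtain ⟨T, hTW, hTker, hTs⟩ := exists_complete_equations (b := 2) W Φ hΦs hWΦ (by
    rw [hW, Module.finrank_fin_fun])
  let P : (Fin 8 → ℂ) →ₗ[ℂ] (Fin 3 ⊕ Fin 2 → ℂ) :=
    (LinearEquiv.sumArrowLequivProdArrow (Fin 3) (Fin 2) ℂ ℂ).symm.toLinearMap ∘ₗ Φ.prod T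
  have hPl : ∀ x k, P x (Sum.inl k) = Φ x k := fun _ _ => rfl
  have hPs : Function.Surjective P :=
    (LinearEquiv.sumArrowLequivProdArrow (Fin 3) (Fin 2) ℂ ℂ).symm.surjective.comp hTs
  have hPker : ∀ x, P x = 0 → x ∈ W := fun x hx =>
    hTker x (funext fun k => congrFun hx (Sum.inl k)) (funext fun c => congrFun hx (Sum.inr c))
  have hWP : ∀ x ∈ W, P x = 0 := fun x hx => by
    ext (k | c)
    · exact congrFun (hWΦ hx) k
    · exact congrFun (hTW hx) c
  obtain ⟨S, hS⟩ := LinearMap.exists_rightInverse_of_surjective P (LinearMap.range_eq_top.2 hPs)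
  have hPS : ∀ c, P (S c) = c := fun c => congrArg (fun f => f c) hS
  obtain ⟨δ, u, a, hsys, hδ, ha, hda⟩ := exists_elimination P S hPS (fun k => hQ _) hF
    (fun k x hx => hGW k x (hPker x hx)) (fun x hx => hFW x (hPker x hx)) (hWP v hv)
    (fun k y => (hPl y k).symm) hFv
  let s : Fin 2 → MvPolynomial (Fin 8) ℂ := fun c => ofDual (LinearMap.proj (Sum.inr c) ∘ₗ P)
  have hs : ∀ c, eval v (s c) = 0 := fun c => by
    rw [eval_ofDual]; exact congrFun (hWP v hv) (Sum.inr c)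
  have hds : ∀ c y, diffAt (s c) v y = T y c := fun c y => diffAt_ofDual _ _ _
  let w := hyperbolicCoordinates s a
  -- The equation of the chart and the three quadrics complete the four `w` to eight coordinates.
  let z : Option (Fin 3) → MvPolynomial (Fin 8) ℂ := fun o => o.elim (X j - 1) G
  have hz : ∀ k, eval v (z k) = 0 := by
    rintro (_ | k)
    · simp [z, hvj]
    · exact hGW k v hv
  have hjac : ∀ y, (∀ k, diffAt (w k) v y = 0) → (∀ k, diffAt (z k) v y = 0) → y = 0 := by
    intro y hwy hzy
    have hT : T y = 0 := funext fun c => by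
      rw [← hds]; exact (diffAt_hyperbolicCoordinates hwy c).1
    have hyW : y ∈ W := hTker y (funext fun k => hzy (some k)) hT
    have hyj : y j = 0 := by
      have h := hzy none
      simp only [z, Option.elim_none, diffAt_apply, map_sub, dirDeriv_apply, pderiv_X,
        Pi.single_apply, pderiv_one] at h
      simpa using h
    -- The differential of `F` at `y` vanishes on `W` and, as the differentials of `a` kill `y`, it
    -- involves only the differentials of `G` at `v`. Minus its coefficients there give a
    -- deformation in the direction `y`. Hence `y` is a multiple of `v`, and `y j = 0` forces it to
    -- be zero.
    let ν : Fin 3 → ℂ := fun k => - diffAt F y (S (Pi.single (Sum.inl k) 1))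
    have hνy : ∀ x, ∑ i, l i * diffAt (Q i) y x +
        ∑ i, (i₀.insertNth 0 ν : Fin 4 → ℂ) i * diffAt (Q i) v x = 0 := by
      intro x
      rw [hins, ← hdF]
      have h1 : x - S (P x) ∈ W := hPker _ (by rw [map_sub, hPS, sub_self])
      have h2 := diffAt_eq_zero_of_mem hF hFW hyW h1
      rw [map_sub, sub_eq_zero] at h2
      have h3 : diffAt F y (S (P x)) = ∑ i, P x i * diffAt F y (S (Pi.single i 1)) := by
        conv_lhs => rw [← Finset.univ_sum_single (P x), map_sum, map_sum]
        refine Finset.sum_congr rfl fun i _ => ?_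
        rw [show (Pi.single i (P x i) : _ → ℂ) = P x i • Pi.single i 1 by
          rw [← Pi.single_smul, smul_eq_mul, mul_one], map_smul, map_smul, smul_eq_mul]
      rw [h2, h3, Fintype.sum_sum_type]
      have h4 : ∀ c, diffAt F y (S (Pi.single (Sum.inr c) 1)) = 0 := fun c => by
        rw [← hda c y (hWP y hyW)]
        exact (diffAt_hyperbolicCoordinates hwy c).2
      simp only [h4, mul_zero, Finset.sum_const_zero, add_zero, ν, hPl,
        ← Finset.sum_add_distrib]
      exact Finset.sum_eq_zero fun k _ => by ring
    obtain ⟨c, rfl⟩ := Submodule.mem_span_singleton.1 (htan y hyW _ hνy).1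
    rw [Pi.smul_apply, hvj, smul_eq_mul, mul_one] at hyj
    rw [hyj, zero_smul]
  have hzmem : ∀ k, z k ∈ chartIdeal Q j := by
    rintro (_ | k)
    · exact Ideal.subset_span (Or.inr rfl)
    · exact Ideal.subset_span (Or.inl ⟨_, rfl⟩)
  have hQmem : ∀ i, Q i ∈ chartIdeal Q j := fun i => Ideal.subset_span (Or.inl ⟨i, rfl⟩)
  have hFmem : F ∈ chartIdeal Q j := Ideal.sum_mem _ fun i _ => by
    rw [smul_eq_C_mul]; exact Ideal.mul_mem_left _ _ (hQmem i)
  have hwq : aeval w sumSq = δ * F - u ⬝ᵥ G := by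
    rw [aeval_sumSq, hsys, add_sub_cancel_left]
  have hI : ∀ n, chartIdeal Q j ⊔ vanishingAt v ^ n =
      Ideal.span (Set.range z ∪ {aeval w sumSq}) ⊔ vanishingAt v ^ n := by
    intro n
    have hzJ : ∀ k, z k ∈ Ideal.span (Set.range z ∪ {aeval w sumSq}) := fun k =>
      Ideal.subset_span (Or.inl ⟨k, rfl⟩)
    have hGJ : ∀ k, G k ∈ Ideal.span (Set.range z ∪ {aeval w sumSq}) := fun k => hzJ (some k)
    have hFJ : F ∈ Ideal.span (Set.range z ∪ {aeval w sumSq}) ⊔ vanishingAt v ^ n := by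
      refine mem_of_mul_mem_sup (δ := δ) (by simp [RingHom.mem_ker, hδ]) ?_ n
      have h1 : δ * F = aeval w sumSq + u ⬝ᵥ G := by rw [hwq, sub_add_cancel]
      rw [h1]
      exact Ideal.add_mem _ (Ideal.subset_span (Or.inr rfl))
        (Ideal.sum_mem _ fun k _ => Ideal.mul_mem_left _ _ (hGJ k))
    apply le_antisymm
    · refine sup_le (Ideal.span_le.2 ?_) le_sup_right
      rintro _ (⟨i, rfl⟩ | hx)
      · rcases Fin.eq_self_or_eq_succAbove i₀ i with rfl | ⟨k, rfl⟩
        · have h1 : F = l i • Q i + ∑ k, l (i.succAbove k) • G k :=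
            Fin.sum_univ_succAbove _ i
          -- The discarded quadric is recovered from `F` and `G` because its coefficient in `F` is
          -- invertible.
          have h2 : Q i = C (l i)⁻¹ * (F - ∑ k, C (l (i.succAbove k)) * G k) := by
            simp only [smul_eq_C_mul] at h1
            rw [h1, add_sub_cancel_right, ← mul_assoc, ← C_mul, inv_mul_cancel₀ hi₀, C_1,
              one_mul]
          rw [SetLike.mem_coe, h2]
          exact Ideal.mul_mem_left _ _ (Ideal.sub_mem _ hFJ
            (Ideal.sum_mem _ fun k _ => Ideal.mul_mem_left _ _ (Ideal.mem_sup_left (hGJ k))))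
        · exact Ideal.mem_sup_left (hGJ k)
      · rw [Set.mem_singleton_iff.1 hx]
        exact Ideal.mem_sup_left (hzJ none)
    · refine sup_le (Ideal.span_le.2 ?_) le_sup_right
      rintro _ (⟨k, rfl⟩ | hx)
      · exact Ideal.mem_sup_left (hzmem k)
      · rw [Set.mem_singleton_iff.1 hx, hwq]
        exact Ideal.mem_sup_left (Ideal.sub_mem _ (Ideal.mul_mem_left _ _ hFmem)
          (Ideal.sum_mem _ fun k _ => Ideal.mul_mem_left _ _ (hQmem _)))
  have hmain := nonempty_adicCompletion_algEquiv_of_coordinates v (chartIdeal Q j) w z (by simp)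
    (eval_hyperbolicCoordinates hs ha) hz
    (fun y h1 h2 => hjac y (fun k => by rw [← sum_eval_pderiv_mul]; exact h1 k)
      fun k => by rw [← sum_eval_pderiv_mul]; exact h2 k) isHomogeneous_sumSq hI
  rw [coe_sumSq] at hmain
  exact hmain

/-! ### From singular points on the plane to degeneracy of a 4 × 5 matrix -/

theorem not_linearIndependent_differential_iff (Q : Fin 4 → MvPolynomial (Fin 8) ℂ)
    (x : Fin 8 → ℂ) : (¬ LinearIndependent ℂ fun i => differential (Q i) x) ↔
      ∃ l : Fin 4 → ℂ, l ≠ 0 ∧ ∀ y, ∑ i, l i * diffAt (Q i) x y = 0 := by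
  have key : ∀ l : Fin 4 → ℂ, (∑ i, l i • differential (Q i) x = 0) ↔
      ∀ y, ∑ i, l i * diffAt (Q i) x y = 0 := by
    intro l
    have h1 : ∀ y, ∑ i, l i * diffAt (Q i) x y =
        ∑ k, (∑ i, l i • differential (Q i) x) k * y k := by
      intro y
      simp only [← sum_eval_pderiv_mul, Finset.mul_sum, Finset.sum_apply, Pi.smul_apply,
        smul_eq_mul, differential, Finset.sum_mul, ← mul_assoc]
      exact Finset.sum_comm
    simp only [h1]
    constructor
    · intro h y
      exact Finset.sum_eq_zero fun k _ => by rw [h, Pi.zero_apply, zero_mul]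
    · intro h
      ext k
      simpa [Pi.single_apply] using h (Pi.single k 1)
  rw [Fintype.not_linearIndependent_iff]
  simp only [key]
  constructor
  · rintro ⟨l, h, i, hi⟩
    exact ⟨l, fun h0 => hi (congrFun h0 i), h⟩
  · rintro ⟨l, h0, h⟩
    exact ⟨l, h, Function.ne_iff.1 h0⟩

theorem rep_mem_iff_mem_pointsOf (P : P7) (W : Submodule ℂ (Fin 8 → ℂ)) :
    P ∈ pointsOf W ↔ P.rep ∈ W := by
  rw [pointsOf, Set.mem_ofPred_eq, Projectivization.submodule_eq, Submodule.span_singleton_le_iff_mem]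

theorem eval_eq_zero_of_mem_plane {Q : Fin 4 → MvPolynomial (Fin 8) ℂ}
    (hQ : ∀ i, (Q i).IsHomogeneous 2) {W : Submodule ℂ (Fin 8 → ℂ)}
    (hplane : pointsOf W ⊆ baseLocus Q) (i : Fin 4) (x : Fin 8 → ℂ) (hx : x ∈ W) :
    eval x (Q i) = 0 := by
  by_cases h0 : x = 0
  · have := eval_smul_eq (hQ i) 0 x
    rw [h0, zero_smul] at this
    simpa [h0] using this
  · have h1 : Projectivization.mk ℂ x h0 ∈ pointsOf W := by
      rw [pointsOf, Set.mem_ofPred_eq, Projectivization.submodule_mk,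
        Submodule.span_singleton_le_iff_mem]
      exact hx
    refine hplane h1 i x ?_
    rw [Projectivization.submodule_mk]
    exact Submodule.mem_span_singleton_self x

/-- If four quadrics through a plane have exactly ten singular points on it, then at each of these
points the linear relation between the differentials of the quadrics has no first order
deformation along the plane. -/
theorem tangent_trivial_of_ncard_eq_ten {Q : Fin 4 → MvPolynomial (Fin 8) ℂ}
    (hQ : ∀ i, (Q i).IsHomogeneous 2) {W : Submodule ℂ (Fin 8 → ℂ)}
    (hW : Module.finrank ℂ W = 3) (hplane : pointsOf W ⊆ baseLocus Q)
    (hten : (singularLocus Q ∩ pointsOf W).ncard = 10)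
    {P : P7} (hP : P ∈ singularLocus Q) (hPW : P ∈ pointsOf W) {l : Fin 4 → ℂ} (hl : l ≠ 0)
    (hlP : ∀ y, ∑ i, l i * diffAt (Q i) P.rep y = 0) {t : Fin 8 → ℂ} (ht : t ∈ W) {ν : Fin 4 → ℂ}
    (htan : ∀ y, ∑ i, l i * diffAt (Q i) t y + ∑ i, ν i * diffAt (Q i) P.rep y = 0) :
    t ∈ Submodule.span ℂ {P.rep} ∧ ν ∈ Submodule.span ℂ {l} := by
  classical
  have hQW := eval_eq_zero_of_mem_plane hQ hplane
  let φ : (Fin 3 → ℂ) ≃ₗ[ℂ] W := (Module.finBasisOfFinrankEq ℂ W hW).equivFun.symm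
  -- Differentials at points of `W` vanish on `W`, so the five directions of a complement determine
  -- them.
  obtain ⟨C, hC⟩ := W.exists_isCompl
  have hCdim : Module.finrank ℂ C = 5 := by
    have := Submodule.finrank_add_eq_of_isCompl hC
    rw [hW, Module.finrank_fin_fun] at this
    lia
  let e := Module.finBasisOfFinrankEq ℂ C hCdim
  let L : Fin 3 → Matrix (Fin 4) (Fin 5) ℂ := fun k =>
    Matrix.of fun i j => diffAt (Q i) (φ (Pi.single k 1) : Fin 8 → ℂ) (e j : Fin 8 → ℂ)
  have hL : ∀ s i j, linMatrix L s i j = diffAt (Q i) (φ s : Fin 8 → ℂ) (e j : Fin 8 → ℂ) := by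
    intro s i j
    rw [diffAt_comm (hQ i)]
    refine Eq.trans ?_ (sum_apply_single_mul
      (diffAt (Q i) (e j : Fin 8 → ℂ) ∘ₗ W.subtype ∘ₗ φ.toLinearMap) s)
    change ∑ k, L k i j * s k = _
    exact Finset.sum_congr rfl fun k _ => congrArg (· * s k) (diffAt_comm (hQ i) _ _)
  have hvec : ∀ (l : Fin 4 → ℂ) s j, Matrix.vecMul l (linMatrix L s) j =
      ∑ i, l i * diffAt (Q i) (φ s : Fin 8 → ℂ) (e j : Fin 8 → ℂ) := fun l s j => by
    simp only [Matrix.vecMul, dotProduct, hL]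
  have hvec0 : ∀ (l : Fin 4 → ℂ) s, Matrix.vecMul l (linMatrix L s) = 0 →
      ∀ y, ∑ i, l i * diffAt (Q i) (φ s : Fin 8 → ℂ) y = 0 := by
    intro l s h y
    let f : (Fin 8 → ℂ) →ₗ[ℂ] ℂ := ∑ i, l i • diffAt (Q i) (φ s : Fin 8 → ℂ)
    have hf : ∀ y, f y = ∑ i, l i * diffAt (Q i) (φ s : Fin 8 → ℂ) y := fun y => by
      simp [f]
    rw [← hf]
    have hWf : W ≤ LinearMap.ker f := fun w hw => by
      rw [LinearMap.mem_ker, hf]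
      exact Finset.sum_eq_zero fun i _ => by
        rw [diffAt_eq_zero_of_mem (hQ i) (hQW i) (φ s).2 hw, mul_zero]
    have hCf : C ≤ LinearMap.ker f := fun c hc => by
      have h1 : f ∘ₗ C.subtype = 0 := e.ext fun j => by
        rw [LinearMap.comp_apply, Submodule.subtype_apply, hf, ← hvec, h]
        rfl
      exact congrArg (fun g => g ⟨c, hc⟩) h1
    have := sup_le hWf hCf
    rw [hC.sup_eq_top] at this
    exact this trivial
  let Z := singularLocus Q ∩ pointsOf W
  have hfin : Finite Z := Set.finite_of_ncard_ne_zero (by rw [hten]; norm_num)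
  let ε : Z ≃ Fin 10 := Finite.equivFinOfCardEq (by rw [Nat.card_coe_set_eq, hten])
  let R : Fin 10 → P7 := fun i => (ε.symm i).1
  have hRW : ∀ i, (R i).rep ∈ W := fun i => (rep_mem_iff_mem_pointsOf _ _).1 (ε.symm i).2.2
  let p : Fin 10 → Fin 3 → ℂ := fun i => φ.symm ⟨(R i).rep, hRW i⟩
  have hφp : ∀ i, (φ (p i) : Fin 8 → ℂ) = (R i).rep := fun i => by simp [p]
  have hspan : ∀ s i, (φ s : Fin 8 → ℂ) ∈ Submodule.span ℂ {(R i).rep} →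
      s ∈ Submodule.span ℂ {p i} := by
    intro s i h
    obtain ⟨c, hc⟩ := Submodule.mem_span_singleton.1 h
    refine Submodule.mem_span_singleton.2 ⟨c, φ.injective (Subtype.ext ?_)⟩
    rw [map_smul, Submodule.coe_smul, hφp, hc]
  have hp0 : ∀ i, p i ≠ 0 := fun i h => (R i).rep_nonzero (by rw [← hφp, h, map_zero]; rfl)
  have hp : ∀ i j, i ≠ j → p i ∉ Submodule.span ℂ {p j} := by
    intro i j hij h
    obtain ⟨c, hc⟩ := Submodule.mem_span_singleton.1 h
    have h1 : c • (R j).rep = (R i).rep := by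
      rw [← hφp, ← hφp, ← hc, map_smul, Submodule.coe_smul]
    refine hij (ε.symm.injective (Subtype.ext ?_))
    change R i = R j
    rw [← (R i).mk_rep, ← (R j).mk_rep, Projectivization.mk_eq_mk_iff']
    exact ⟨c, h1⟩
  have hdeg : ∀ i, ∃ l, l ≠ 0 ∧ Matrix.vecMul l (linMatrix L (p i)) = 0 := by
    intro i
    obtain ⟨l, hl, h⟩ := (not_linearIndependent_differential_iff Q _).1 (ε.symm i).2.1.2
    refine ⟨l, hl, funext fun j => ?_⟩
    rw [hvec, hφp]
    exact h _
  -- The whole plane lies on the quadrics, so a degeneracy point of `L` is a singular point and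
  -- hence one of the ten.
  have hall : ∀ s, s ≠ 0 → ∀ l, l ≠ 0 → Matrix.vecMul l (linMatrix L s) = 0 →
      ∃ i, s ∈ Submodule.span ℂ {p i} := by
    intro s hs l hl h
    have hx : (φ s : Fin 8 → ℂ) ≠ 0 := fun h0 =>
      hs (φ.map_eq_zero_iff.1 (Subtype.ext h0))
    let P' : P7 := Projectivization.mk ℂ (φ s : Fin 8 → ℂ) hx
    have hsub : P'.submodule = Submodule.span ℂ {(φ s : Fin 8 → ℂ)} :=
      Projectivization.submodule_mk _ _
    have hP'W : P' ∈ pointsOf W := by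
      rw [pointsOf, Set.mem_ofPred_eq, hsub, Submodule.span_singleton_le_iff_mem]
      exact (φ s).2
    have hrep : P'.rep ∈ Submodule.span ℂ {(φ s : Fin 8 → ℂ)} := by
      rw [← hsub, Projectivization.submodule_eq]
      exact Submodule.mem_span_singleton_self _
    obtain ⟨c, hc⟩ := Submodule.mem_span_singleton.1 hrep
    have hP' : P' ∈ singularLocus Q := by
      refine ⟨hplane hP'W, (not_linearIndependent_differential_iff Q _).2 ⟨l, hl, fun y => ?_⟩⟩
      have h1 := hvec0 l s h y
      rw [← hc]
      simp only [diffAt_smul_left (hQ _), mul_left_comm _ c, ← Finset.mul_sum, h1, mul_zero]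
    refine ⟨ε ⟨P', hP', hP'W⟩, hspan _ _ ?_⟩
    have h2 : R (ε ⟨P', hP', hP'W⟩) = P' := by simp [R]
    rw [h2, ← Projectivization.submodule_eq, hsub]
    exact Submodule.mem_span_singleton_self _
  let i₀ : Fin 10 := ε ⟨P, hP, hPW⟩
  have hR : R i₀ = P := by simp [R, i₀]
  have hφi : (φ (p i₀) : Fin 8 → ℂ) = P.rep := by rw [hφp, hR]
  have hφt : (φ (φ.symm ⟨t, ht⟩) : Fin 8 → ℂ) = t := by simp
  obtain ⟨h1, h2⟩ := mem_span_of_tangent L p hp0 hp hdeg hall i₀ l hl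
    (funext fun j => by rw [hvec, hφi]; exact hlP _) (φ.symm ⟨t, ht⟩) ν
    (funext fun j => by rw [Pi.add_apply, hvec, hvec, hφi, hφt]; exact htan _)
  refine ⟨?_, h2⟩
  obtain ⟨c, hc⟩ := Submodule.mem_span_singleton.1 h1
  refine Submodule.mem_span_singleton.2 ⟨c, ?_⟩
  rw [← hφi, ← hφt, ← hc, map_smul, Submodule.coe_smul]

end QuadricWeb

open QuadricWeb in
theorem lemma1p6
    (Q : Fin 4 → MvPolynomial (Fin 8) ℂ)
    (hQ : ∀ i, (Q i).IsHomogeneous 2)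
    (hlin : LinearIndependent ℂ Q)
    (W : Submodule ℂ (Fin 8 → ℂ)) (hW : Module.finrank ℂ W = 3)
    (hplane : QuadricWeb.pointsOf W ⊆ QuadricWeb.baseLocus Q)
    (hten : (QuadricWeb.singularLocus Q ∩ QuadricWeb.pointsOf W).ncard = 10)
    (hsmooth : QuadricWeb.singularLocus Q ⊆ QuadricWeb.pointsOf W) :
    ∀ P ∈ QuadricWeb.singularLocus Q, QuadricWeb.IsNode Q P := by
  intro P hP
  refine ⟨hP.1, fun j v hv hvj => ?_⟩
  have hPW := hsmooth hP
  obtain ⟨l, hl, hlP⟩ := (not_linearIndependent_differential_iff Q _).1 hP.2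
  have hvW : v ∈ W := hPW hv
  rw [Projectivization.submodule_eq] at hv
  obtain ⟨c, rfl⟩ := Submodule.mem_span_singleton.1 hv
  have hc : c ≠ 0 := by
    rintro rfl
    simp at hvj
  -- The chart vector is a multiple `c` of the chosen representative; rescaling `ν` by `c` absorbs
  -- the difference.
  have hdiff : ∀ (ν : Fin 4 → ℂ) y, ∑ i, ν i * diffAt (Q i) (c • P.rep) y =
      ∑ i, (c • ν) i * diffAt (Q i) P.rep y := fun ν y =>
    Finset.sum_congr rfl fun i _ => by
      rw [diffAt_smul_left (hQ i), Pi.smul_apply, smul_eq_mul]; ring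
  refine nonempty_completedLocalRing_algEquiv Q hQ W hW (eval_eq_zero_of_mem_plane hQ hplane)
    hvW hvj hl (fun y => ?_) fun t ht ν htan => ?_
  · rw [hdiff]
    simp only [Pi.smul_apply, smul_eq_mul, mul_assoc, ← Finset.mul_sum, hlP, mul_zero]
  · obtain ⟨h1, h2⟩ := tangent_trivial_of_ncard_eq_ten hQ hW hplane hten hP hPW hl hlP ht
      (ν := c • ν) fun y => by rw [← hdiff]; exact htan y
    rw [Submodule.span_singleton_smul_eq (IsUnit.mk0 c hc)]
    exact ⟨h1, (Submodule.smul_mem_iff _ hc).1 h2⟩
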